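/- Let $d\ge 1$, $\mathcal S=\{s\in[0,1]^d:\|s\|_1\le 1\}$ and $\mathrm{Int}(\mathcal S)=\{s\in(0,1)^d:\|s\|_1<1\}$, where $\|s\|_1=\sum_{i=1}^d|s_i|$. For $\alpha_1,\dots,\alpha_d,\beta>0$ let $$K_{\alpha,\beta}(x)=\frac{\Gamma(\|\alpha\|_1+\beta)}{\Gamma(\beta)\prod_{i=1}^d\Gamma(\alpha_i)}(1-\|x\|_1)^{\beta-1}\prod_{i=1}^d x_i^{\alpha_i-1},\qquad x\in\mathcal S,$$ be the Dirichlet density. Let $X_1,X_2,\dots$ be i.i.d. random vectors with a density $f$ supported on $\mathcal S$. For $b>0$, $n\ge1$ and $s\in\mathcal S$ let $$\hat f_{n,b}(s)=\frac1n\sum_{k=1}^nK_{s/b+1,\,(1-\|s\|_1)/b+1}(X_k),\qquad f_b(s)=\int_{\mathcal S}f(x)\,K_{s/b+1,\,(1-\|s\|_1)/b+1}(x)\,dx.$$ For $J\subseteq\{1,\dots,d\}$ and $s\in\mathrm{Int}(\mathcal S)$ let $$\psi_J(s)=\Big[(4\pi)^{d-|J|}(1-\|s\|_1)\prod_{i\notin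 J}s_i\Big]^{-1/2},\qquad \psi=\psi_\emptyset .$$ The estimator $\hat f_{n,b}(s)$ is square integrable for all $n\ge1$, $b>0$, $s\in\mathcal S$, and the following hold. 1. (Bias.) If $f$ is twice continuously differentiable on $\mathcal S$, then $$\mathrm{Bias}[\hat f_{n,b}(s)]=\mathbb E[\hat f_{n,b}(s)]-f(s)=f_b(s)-f(s)=b\,g(s)+o(b)\qquad(b\to0),$$ uniformly in $s\in\mathcal S$ and $n\ge 1$, where $$g(s)=\sum_{i=1}^d(1-(d+1)s_i)\,\partial_if(s)+\frac12\sum_{i,j=1}^ds_i(\mathbf 1_{\{i=j\}}-s_j)\,\partial_i\partial_jf(s).$$ 2. (Variance at an interior point.) If $f$ is Lipschitz continuous on $\mathcal S$, then for every fixed $s\in\mathrm{Int}(\mathcal S)$, as $b\to0$ and uniformly in $n\ge1$, $$\mathrm{Var}(\hat f_{n,b}(s))=n^{-1}b^{-d/2}\big(\psi(s)f(s)+O_s(b^{1/2})\big).$$ 3. (Variance at moving points and near a face.) Let $f$ be Lipschitz continuous on $\mathcal S$, let $J\subseteq\{1,\dots,d\}$ (possibly empty) and $\kappa\in(0,\infty)^d$.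 There is a constant $C$, depending only on $d,f,J,\kappa$, such that for all sequences $b=b(n)>0$ with $b\to0$ and $s=s(n)\in\mathrm{Int}(\mathcal S)$ with $s_i/b\to\kappa_i$ for all $i\in J$, $s_i/b\to\infty$ for all $i\notin J$, and $(1-\|s\|_1)/b\to\infty$ as $n\to\infty$, $$\mathrm{Var}(\hat f_{n,b}(s))=n^{-1}b^{-(d+|J|)/2}\Big(\psi_J(s)f(s)\prod_{i\in J}\frac{\Gamma(2\kappa_i+1)}{2^{2\kappa_i+1}\Gamma(\kappa_i+1)^2}+R_n\Big),$$ where, for all sufficiently large $n$, $$|R_n|\le C\,\psi_J(s)\Big(b^{1/2}\Big[(1-\|s\|_1)^{-1/2}+\sum_{i\notin J}s_i^{-1/2}\Big]+\sum_{i\in J}\Big|\frac{s_i}{b}-\kappa_i\Big|\Big).$$ In particular, $R_n=O(b^{1/2})$ if $s_i/b-\kappa_i=O(b^{1/2})$ for $i\in J$, while $1-\|s\|_1$ and the $s_i$ with $i\notin J$ stay bounded away from $0$. -/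

import Mathlib

open MeasureTheory ProbabilityTheory Filter Topology

noncomputable section

namespace DirichletKernel

/-- The `ℓ¹` norm on `ℝ^d`. -/
def l1norm {d : ℕ} (s : Fin d → ℝ) : ℝ := ∑ i, |s i|

/-- The closed simplex `{s ∈ [0,1]^d : ‖s‖₁ ≤ 1}`. -/
def simplex (d : ℕ) : Set (Fin d → ℝ) :=
  {s | (∀ i, s i ∈ Set.Icc (0 : ℝ) 1) ∧ l1norm s ≤ 1}

/-- The open simplex `{s ∈ (0,1)^d : ‖s‖₁ < 1}`. -/
def simplexInt (d : ℕ) : Set (Fin d → ℝ) :=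
  {s | (∀ i, s i ∈ Set.Ioo (0 : ℝ) 1) ∧ l1norm s < 1}

/-- The density of the `Dirichlet(α, β)` distribution on the simplex. -/
def dirichletDensity {d : ℕ} (α : Fin d → ℝ) (β : ℝ) (x : Fin d → ℝ) : ℝ :=
  Real.Gamma (l1norm α + β) / (Real.Gamma β * ∏ i, Real.Gamma (α i)) *
    ((1 - l1norm x) ^ (β - 1) * ∏ i, x i ^ (α i - 1))

/-- The Dirichlet kernel `K_{s/b + 1, (1 - ‖s‖₁)/b + 1}` attached to the point `s`. -/
def kernel {d : ℕ} (b : ℝ) (s : Fin d → ℝ) : (Fin d → ℝ) → ℝ :=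
  dirichletDensity (fun i => s i / b + 1) ((1 - l1norm s) / b + 1)

/-- The Dirichlet kernel estimator built from the first `n` observations. -/
def estimator {d : ℕ} {Ω : Type*} (X : ℕ → Ω → Fin d → ℝ) (n : ℕ) (b : ℝ)
    (s : Fin d → ℝ) (ω : Ω) : ℝ :=
  (n : ℝ)⁻¹ * ∑ k ∈ Finset.range n, kernel b s (X k ω)

/-- The measure on `ℝ^d` which is supported on the simplex and has Lebesgue density `f` there. -/
def simplexLaw {d : ℕ} (f : (Fin d → ℝ) → ℝ) : Measure (Fin d → ℝ) :=
  ((volume : Measure (Fin d → ℝ)).restrict (simplex d)).withDensity fun x => ENNReal.ofReal (f x)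

/-- The smoothed density `f_b(s) = ∫_S f(x) K_{s/b + 1, (1 - ‖s‖₁)/b + 1}(x) dx`. -/
def smoothed {d : ℕ} (f : (Fin d → ℝ) → ℝ) (b : ℝ) (s : Fin d → ℝ) : ℝ :=
  ∫ x in simplex d, f x * kernel b s x

/-- The bias of the estimator: `E[f̂_{n,b}(s)] - f(s)`. -/
def bias {d : ℕ} {Ω : Type*} [MeasurableSpace Ω] (μ : Measure Ω) (f : (Fin d → ℝ) → ℝ)
    (X : ℕ → Ω → Fin d → ℝ) (n : ℕ) (b : ℝ) (s : Fin d → ℝ) : ℝ :=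
  (∫ ω, estimator X n b s ω ∂μ) - f s

/-- The partial derivative `∂f/∂s_i` on the closed simplex (one-sided at the boundary). -/
def partialDeriv {d : ℕ} (i : Fin d) (f : (Fin d → ℝ) → ℝ) (s : Fin d → ℝ) : ℝ :=
  fderivWithin ℝ f (simplex d) s (Pi.single i 1)

/-- `g = ∑ᵢ (1 - (d+1) sᵢ) ∂ᵢ f + ½ ∑ᵢⱼ sᵢ (1_{i=j} - sⱼ) ∂ᵢ∂ⱼ f`. -/
def biasTerm {d : ℕ} (f : (Fin d → ℝ) → ℝ) (s : Fin d → ℝ) : ℝ :=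
  ∑ i, (1 - ((d : ℝ) + 1) * s i) * partialDeriv i f s +
    1 / 2 * ∑ i, ∑ j, s i * ((if i = j then 1 else 0) - s j) *
      partialDeriv i (partialDeriv j f) s

/-- `ψ_J(s) = [(4π)^{d-|J|} (1 - ‖s‖₁) ∏_{i ∉ J} sᵢ]^{-1/2}`; `ψ = ψ_∅`. -/
def psi {d : ℕ} (J : Finset (Fin d)) (s : Fin d → ℝ) : ℝ :=
  ((4 * Real.pi) ^ (d - J.card) * (1 - l1norm s) * ∏ i ∈ Jᶜ, s i) ^ (-(1 / 2) : ℝ)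

/-- `Γ(2κ + 1) / (2^{2κ+1} Γ(κ + 1)²)`. -/
def gammaRatio (κ : ℝ) : ℝ :=
  Real.Gamma (2 * κ + 1) / ((2 : ℝ) ^ (2 * κ + 1) * Real.Gamma (κ + 1) ^ 2)

end DirichletKernel

end

namespace DirichletKernel

/-- The power `x ^ (a - 1)` truncated to the nonnegative half line. -/
noncomputable def truncPow (a x : ℝ) : ENNReal :=
  if 0 ≤ x then ENNReal.ofReal (x ^ (a - 1)) else 0

lemma measurable_truncPow (a : ℝ) : Measurable (truncPow a) :=
  Measurable.ite measurableSet_Ici (by fun_prop) measurable_const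

lemma lintegral_comp_const_mul {t : ℝ} (ht : 0 < t) (F : ℝ → ENNReal) (hF : Measurable F) :
    ∫⁻ x, F x = ENNReal.ofReal t * ∫⁻ y, F (t * y) := by
  conv_lhs => rw [← Real.smul_map_volume_mul_left ht.ne']
  rw [lintegral_smul_measure, lintegral_map hF (by fun_prop), abs_of_pos ht, smul_eq_mul]

lemma truncPow_convolution {a b : ℝ} (ha : 1 ≤ a) (hb : 1 ≤ b) (t : ℝ) :
    ∫⁻ x, truncPow a x * truncPow b (t - x) =
      ENNReal.ofReal (beta a b) * truncPow (a + b) t := by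
  have hm : Measurable fun x => truncPow a x * truncPow b (t - x) :=
    (measurable_truncPow a).mul ((measurable_truncPow b).comp (by fun_prop))
  have hB : 0 < beta a b := beta_pos (by linarith) (by linarith)
  rcases lt_trichotomy t 0 with ht | rfl | ht
  · have h0 : ∀ x, truncPow a x * truncPow b (t - x) = 0 := by
      intro x
      unfold truncPow
      by_cases hx : 0 ≤ x
      · rw [if_neg (show ¬ 0 ≤ t - x by linarith), mul_zero]
      · rw [if_neg hx, zero_mul]
    rw [lintegral_congr h0]
    simp [truncPow, ht.not_ge]
  · have h0 : (fun x => truncPow a x * truncPow b (0 - x)) =ᵐ[volume] fun _ => 0 := by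
      filter_upwards [Measure.ae_ne volume (0 : ℝ)] with x hx
      unfold truncPow
      by_cases hx' : 0 ≤ x
      · have : 0 < x := lt_of_le_of_ne hx' (Ne.symm hx)
        rw [if_neg (show ¬ 0 ≤ 0 - x by linarith), mul_zero]
      · rw [if_neg hx', zero_mul]
    rw [lintegral_congr_ae h0]
    have h1 : a + b - 1 ≠ 0 := by linarith
    simp [truncPow, Real.zero_rpow h1]
  · rw [lintegral_comp_const_mul ht _ hm]
    have h0 : (fun y => truncPow a (t * y) * truncPow b (t - t * y)) =ᵐ[volume]
        fun y => ENNReal.ofReal (t ^ (a + b - 2) * beta a b) * betaPDF a b y := by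
      filter_upwards [Measure.ae_ne volume (0 : ℝ), Measure.ae_ne volume (1 : ℝ)] with y h0 h1
      unfold truncPow betaPDF betaPDFReal
      by_cases hy : 0 < y ∧ y < 1
      · have hy1 : 0 < 1 - y := by linarith [hy.2]
        have e : t - t * y = t * (1 - y) := by ring
        rw [if_pos hy, e, if_pos (by nlinarith [hy.1]), if_pos (by positivity),
          ← ENNReal.ofReal_mul (Real.rpow_nonneg (by nlinarith [hy.1]) _),
          ← ENNReal.ofReal_mul (by positivity)]
        congr 1
        rw [Real.mul_rpow ht.le hy.1.le, Real.mul_rpow ht.le hy1.le,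
          show a + b - 2 = (a - 1) + (b - 1) by ring, Real.rpow_add ht]
        field_simp
      · rw [if_neg hy, ENNReal.ofReal_zero, mul_zero]
        by_cases hy0 : 0 < y
        · have : 1 < y := lt_of_le_of_ne (not_lt.1 fun h => hy ⟨hy0, h⟩) (Ne.symm h1)
          rw [if_neg (show ¬ 0 ≤ t - t * y by nlinarith), mul_zero]
        · have : y < 0 := lt_of_le_of_ne (not_lt.1 hy0) h0
          rw [if_neg (show ¬ 0 ≤ t * y by nlinarith), zero_mul]
    rw [lintegral_congr_ae h0, lintegral_const_mul' _ _ ENNReal.ofReal_ne_top,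
      lintegral_betaPDF_eq_one (by linarith) (by linarith), mul_one, truncPow, if_pos ht.le,
      ← ENNReal.ofReal_mul ht.le, ← ENNReal.ofReal_mul hB.le]
    congr 1
    rw [show a + b - 1 = 1 + (a + b - 2) by ring, Real.rpow_add ht, Real.rpow_one]
    ring

/-- The normalizing constant of the Dirichlet distribution. -/
noncomputable def dirichletConst {d : ℕ} (α : Fin d → ℝ) (β : ℝ) : ℝ :=
  Real.Gamma β * (∏ i, Real.Gamma (α i)) / Real.Gamma (∑ i, α i + β)

lemma lintegral_truncPow (d : ℕ) (α : Fin d → ℝ) (hα : ∀ i, 1 ≤ α i) (β : ℝ) (hβ : 1 ≤ β) (t : ℝ) :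
    ∫⁻ x : Fin d → ℝ, truncPow β (t - ∑ i, x i) * ∏ i, truncPow (α i) (x i) =
      ENNReal.ofReal (dirichletConst α β) * truncPow (∑ i, α i + β) t := by
  induction d generalizing t with
  | zero =>
    have : Real.Gamma β ≠ 0 := (Real.Gamma_pos_of_pos (by linarith)).ne'
    simp [dirichletConst, lintegral_unique, this, volume_pi]
  | succ d ih =>
    have hmeas : ∀ (n : ℕ) (α : Fin n → ℝ) (u : ℝ), Measurable fun x : Fin n → ℝ =>
        truncPow β (u - ∑ i, x i) * ∏ i, truncPow (α i) (x i) := fun n α u =>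
      ((measurable_truncPow β).comp (by fun_prop)).mul
        (Finset.measurable_fun_prod _ fun i _ =>
          (measurable_truncPow _).comp (measurable_pi_apply i))
    have e := (volume_preserving_piFinSuccAbove (fun _ : Fin (d + 1) => ℝ) 0).symm
    rw [← e.lintegral_comp (hmeas _ α t), Measure.volume_eq_prod]
    refine (lintegral_prod _ ((hmeas _ α t).comp e.measurable).aemeasurable).trans ?_
    simp only [Function.comp_def]
    have hS : 0 ≤ ∑ i : Fin d, α i.succ := Finset.sum_nonneg fun i _ => by linarith [hα i.succ]
    have key : ∀ x0 : ℝ, (∫⁻ x : Fin d → ℝ,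
        truncPow β (t - ∑ i, (MeasurableEquiv.piFinSuccAbove (fun _ : Fin (d + 1) => ℝ) 0).symm
          (x0, x) i) * ∏ i, truncPow (α i)
          ((MeasurableEquiv.piFinSuccAbove (fun _ : Fin (d + 1) => ℝ) 0).symm (x0, x) i)) =
        ENNReal.ofReal (dirichletConst (fun i : Fin d => α i.succ) β) * (truncPow (α 0) x0 *
          truncPow (∑ i : Fin d, α i.succ + β) (t - x0)) := by
      intro x0
      have := ih (fun i => α i.succ) (fun i => hα _) (t - x0)
      rw [mul_left_comm, ← this, ← lintegral_const_mul _ (hmeas _ _ _)]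
      refine lintegral_congr fun x => ?_
      rw [Fin.sum_univ_succ, Fin.prod_univ_succ]
      simp [MeasurableEquiv.piFinSuccAbove_symm_apply, Fin.insertNthEquiv, ← sub_sub]
      ring
    rw [lintegral_congr key, lintegral_const_mul' _ _ ENNReal.ofReal_ne_top,
      truncPow_convolution (hα 0) (by linarith), ← mul_assoc, Fin.sum_univ_succ, add_assoc]
    congr 1
    have hG : Real.Gamma (∑ i : Fin d, α i.succ + β) ≠ 0 :=
      (Real.Gamma_pos_of_pos (by linarith)).ne'
    rw [← ENNReal.ofReal_mul]
    · congr 1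
      unfold dirichletConst beta
      rw [Fin.sum_univ_succ, Fin.prod_univ_succ, add_assoc]
      field_simp
    · exact div_nonneg (mul_nonneg (Real.Gamma_pos_of_pos (by linarith)).le
        (Finset.prod_nonneg fun i _ => (Real.Gamma_pos_of_pos (by linarith [hα i.succ])).le))
        (Real.Gamma_pos_of_pos (by linarith)).le

lemma l1norm_eq_sum {d : ℕ} {x : Fin d → ℝ} (hx : ∀ i, 0 ≤ x i) : l1norm x = ∑ i, x i :=
  Finset.sum_congr rfl fun i _ => abs_of_nonneg (hx i)

lemma mem_simplex_iff {d : ℕ} {x : Fin d → ℝ} :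
    x ∈ simplex d ↔ (∀ i, 0 ≤ x i) ∧ ∑ i, x i ≤ 1 := by
  constructor
  · rintro ⟨h1, h2⟩
    have h : ∀ i, 0 ≤ x i := fun i => (h1 i).1
    exact ⟨h, by rwa [← l1norm_eq_sum h]⟩
  · rintro ⟨h, h2⟩
    refine ⟨fun i => ⟨h i, ?_⟩, by rwa [l1norm_eq_sum h]⟩
    exact (Finset.single_le_sum (fun j _ => h j) (Finset.mem_univ i)).trans h2

lemma isClosed_simplex (d : ℕ) : IsClosed (simplex d) := by
  have : simplex d = (⋂ i, {x | 0 ≤ x i}) ∩ {x | ∑ i, x i ≤ 1} := by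
    ext x; simp [mem_simplex_iff]
  rw [this]
  exact (isClosed_iInter fun i => isClosed_le continuous_const (continuous_apply i)).inter
    (isClosed_le (by fun_prop) continuous_const)

lemma measurableSet_simplex (d : ℕ) : MeasurableSet (simplex d) :=
  (isClosed_simplex d).measurableSet

lemma isCompact_simplex (d : ℕ) : IsCompact (simplex d) :=
  (isCompact_univ_pi fun _ : Fin d => isCompact_Icc (a := (0 : ℝ)) (b := 1)).of_isClosed_subset
    (isClosed_simplex d) fun _ hx i _ => hx.1 i

lemma convex_simplex (d : ℕ) : Convex ℝ (simplex d) := by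
  intro x hx y hy a b ha hb hab
  rw [mem_simplex_iff] at *
  refine ⟨fun i => ?_, ?_⟩
  · have := hx.1 i
    have := hy.1 i
    simp only [Pi.add_apply, Pi.smul_apply, smul_eq_mul]
    positivity
  · simp only [Pi.add_apply, Pi.smul_apply, smul_eq_mul, Finset.sum_add_distrib, ← Finset.mul_sum]
    nlinarith [hx.2, hy.2]

lemma l1norm_of_mem {d : ℕ} {x : Fin d → ℝ} (hx : x ∈ simplex d) : l1norm x = ∑ i, x i :=
  l1norm_eq_sum (mem_simplex_iff.1 hx).1

lemma l1norm_pos_params {d : ℕ} {α : Fin d → ℝ} (hα : ∀ i, 1 ≤ α i) : l1norm α = ∑ i, α i :=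
  l1norm_eq_sum fun i => zero_le_one.trans (hα i)

lemma dirichletDensity_nonneg {d : ℕ} {α : Fin d → ℝ} (hα : ∀ i, 1 ≤ α i) {β : ℝ} (hβ : 1 ≤ β)
    {x : Fin d → ℝ} (hx : x ∈ simplex d) : 0 ≤ dirichletDensity α β x := by
  have h1 : ∀ i, 0 < Real.Gamma (α i) := fun i => Real.Gamma_pos_of_pos (by linarith [hα i])
  have h2 : 0 < Real.Gamma β := Real.Gamma_pos_of_pos (by linarith)
  have h3 : 0 ≤ Real.Gamma (l1norm α + β) :=
    Real.Gamma_nonneg_of_nonneg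
      (add_nonneg (Finset.sum_nonneg fun i _ => abs_nonneg _) (by linarith))
  exact mul_nonneg (div_nonneg h3 (mul_nonneg h2.le (Finset.prod_nonneg fun i _ => (h1 i).le)))
    (mul_nonneg (Real.rpow_nonneg (sub_nonneg.2 hx.2) _)
      (Finset.prod_nonneg fun i _ => Real.rpow_nonneg (hx.1 i).1 _))

lemma continuous_dirichletDensity {d : ℕ} {α : Fin d → ℝ} (hα : ∀ i, 1 ≤ α i) {β : ℝ}
    (hβ : 1 ≤ β) : Continuous (dirichletDensity α β) := by
  refine continuous_const.mul (.mul ?_ (continuous_finsetProd _ fun i _ => ?_))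
  · refine Continuous.rpow_const ?_ fun x => Or.inr (by linarith)
    unfold l1norm
    fun_prop
  · exact (continuous_apply i).rpow_const fun x => Or.inr (by linarith [hα i])

lemma integrableOn_simplex {d : ℕ} {h : (Fin d → ℝ) → ℝ} (hh : ContinuousOn h (simplex d)) :
    IntegrableOn h (simplex d) :=
  hh.integrableOn_compact (isCompact_simplex d)

lemma integral_dirichletDensity {d : ℕ} {α : Fin d → ℝ} (hα : ∀ i, 1 ≤ α i) {β : ℝ}
    (hβ : 1 ≤ β) : ∫ x in simplex d, dirichletDensity α β x = 1 := by
  have h1 : ∀ i, 0 < Real.Gamma (α i) := fun i => Real.Gamma_pos_of_pos (by linarith [hα i])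
  have h2 : 0 < Real.Gamma β := Real.Gamma_pos_of_pos (by linarith)
  have hS : 0 ≤ ∑ i, α i := Finset.sum_nonneg fun i _ => by linarith [hα i]
  have h3 : 0 < Real.Gamma (∑ i, α i + β) := Real.Gamma_pos_of_pos (by linarith)
  have h4 : 0 < ∏ i, Real.Gamma (α i) := Finset.prod_pos fun i _ => h1 i
  rw [integral_eq_lintegral_of_nonneg_ae
    ((ae_restrict_iff' (measurableSet_simplex d)).2 (ae_of_all _ fun x hx =>
      dirichletDensity_nonneg hα hβ hx))
    (continuous_dirichletDensity hα hβ).aestronglyMeasurable]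
  have key : ∫⁻ x in simplex d, ENNReal.ofReal (dirichletDensity α β x) =
      ENNReal.ofReal (dirichletConst α β)⁻¹ *
        ∫⁻ x : Fin d → ℝ, truncPow β (1 - ∑ i, x i) * ∏ i, truncPow (α i) (x i) := by
    rw [← lintegral_const_mul' _ _ ENNReal.ofReal_ne_top,
      ← lintegral_indicator (measurableSet_simplex d)]
    refine lintegral_congr fun x => ?_
    by_cases hx : x ∈ simplex d
    · rw [Set.indicator_of_mem hx]
      have hx' := mem_simplex_iff.1 hx
      have e : ∏ i, truncPow (α i) (x i) = ENNReal.ofReal (∏ i, x i ^ (α i - 1)) := by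
        rw [ENNReal.ofReal_prod_of_nonneg fun i _ => Real.rpow_nonneg (hx'.1 i) _]
        exact Finset.prod_congr rfl fun i _ => if_pos (hx'.1 i)
      rw [e, truncPow, if_pos (sub_nonneg.2 hx'.2),
        ← ENNReal.ofReal_mul (Real.rpow_nonneg (sub_nonneg.2 hx'.2) _),
        ← ENNReal.ofReal_mul (inv_nonneg.2 (by unfold dirichletConst; positivity))]
      congr 1
      rw [dirichletDensity, dirichletConst, inv_div, l1norm_of_mem hx, l1norm_pos_params hα]
    · rw [Set.indicator_of_notMem hx]
      by_cases hx0 : ∀ i, 0 ≤ x i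
      · have : ¬ 0 ≤ 1 - ∑ i, x i := fun h => hx (mem_simplex_iff.2 ⟨hx0, by linarith⟩)
        rw [truncPow, if_neg this, zero_mul, mul_zero]
      · push Not at hx0
        obtain ⟨i, hi⟩ := hx0
        rw [Finset.prod_eq_zero (Finset.mem_univ i) (if_neg hi.not_ge), mul_zero, mul_zero]
  have hc : 0 < dirichletConst α β := by unfold dirichletConst; positivity
  rw [key, lintegral_truncPow d α hα β hβ, ← mul_assoc, ← ENNReal.ofReal_mul (inv_nonneg.2 hc.le),
    inv_mul_cancel₀ hc.ne']
  simp [truncPow]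

lemma one_le_update {d : ℕ} {α : Fin d → ℝ} (hα : ∀ i, 1 ≤ α i) (i : Fin d) :
    ∀ j, 1 ≤ Function.update α i (α i + 1) j := fun j => by
  rcases eq_or_ne j i with rfl | h
  · rw [Function.update_self]; linarith [hα j]
  · rw [Function.update_of_ne h]; exact hα j

lemma sum_update_add_one {d : ℕ} (α : Fin d → ℝ) (i : Fin d) :
    ∑ j, Function.update α i (α i + 1) j = ∑ j, α j + 1 := by
  rw [← Finset.add_sum_erase _ _ (Finset.mem_univ i), ← Finset.add_sum_erase _ α (Finset.mem_univ i),
    Function.update_self, Finset.sum_congr rfl fun j hj =>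
      Function.update_of_ne (Finset.ne_of_mem_erase hj) (α i + 1) α]
  ring

lemma coord_mul_dirichletDensity {d : ℕ} {α : Fin d → ℝ} (hα : ∀ i, 1 ≤ α i) {β : ℝ} (hβ : 1 ≤ β)
    {x : Fin d → ℝ} (hx : x ∈ simplex d) (i : Fin d) :
    x i * dirichletDensity α β x =
      α i / (∑ j, α j + β) * dirichletDensity (Function.update α i (α i + 1)) β x := by
  have hS : 0 ≤ ∑ i, α i := Finset.sum_nonneg fun i _ => by linarith [hα i]
  have hai := hα i
  unfold dirichletDensity
  rw [l1norm_pos_params hα, l1norm_pos_params (one_le_update hα i), sum_update_add_one,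
    ← Finset.mul_prod_erase Finset.univ (fun j => Real.Gamma (α j)) (Finset.mem_univ i),
    ← Finset.mul_prod_erase Finset.univ (fun j => Real.Gamma (Function.update α i (α i + 1) j))
      (Finset.mem_univ i),
    ← Finset.mul_prod_erase Finset.univ (fun j => x j ^ (α j - 1)) (Finset.mem_univ i),
    ← Finset.mul_prod_erase Finset.univ (fun j => x j ^ (Function.update α i (α i + 1) j - 1))
      (Finset.mem_univ i)]
  have e1 : ∏ j ∈ Finset.univ.erase i, Real.Gamma (Function.update α i (α i + 1) j) =
      ∏ j ∈ Finset.univ.erase i, Real.Gamma (α j) := Finset.prod_congr rfl fun j hj => by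
    rw [Function.update_of_ne (Finset.ne_of_mem_erase hj)]
  have e2 : ∏ j ∈ Finset.univ.erase i, x j ^ (Function.update α i (α i + 1) j - 1) =
      ∏ j ∈ Finset.univ.erase i, x j ^ (α j - 1) := Finset.prod_congr rfl fun j hj => by
    rw [Function.update_of_ne (Finset.ne_of_mem_erase hj)]
  rw [e1, e2, Function.update_self, Real.Gamma_add_one (by linarith),
    show ∑ j, α j + 1 + β = (∑ j, α j + β) + 1 by ring,
    Real.Gamma_add_one (s := ∑ j, α j + β) (by linarith),
    show α i + 1 - 1 = (α i - 1) + 1 by ring, Real.rpow_add_one' (hx.1 i).1 (by linarith)]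
  have h1 : Real.Gamma (α i) ≠ 0 := (Real.Gamma_pos_of_pos (by linarith)).ne'
  have h2 : Real.Gamma β ≠ 0 := (Real.Gamma_pos_of_pos (by linarith)).ne'
  have h3 : ∏ j ∈ Finset.univ.erase i, Real.Gamma (α j) ≠ 0 := Finset.prod_ne_zero_iff.2
    fun j _ => (Real.Gamma_pos_of_pos (by linarith [hα j])).ne'
  have h4 : ∑ j, α j + β ≠ 0 := by linarith
  have h5 : α i ≠ 0 := by linarith
  field_simp

lemma integral_coord_mul {d : ℕ} {α : Fin d → ℝ} (hα : ∀ i, 1 ≤ α i) {β : ℝ} (hβ : 1 ≤ β)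
    (h : (Fin d → ℝ) → ℝ) (i : Fin d) :
    ∫ x in simplex d, x i * h x * dirichletDensity α β x =
      α i / (∑ j, α j + β) *
        ∫ x in simplex d, h x * dirichletDensity (Function.update α i (α i + 1)) β x := by
  rw [← integral_const_mul]
  refine setIntegral_congr_fun (measurableSet_simplex d) fun x hx => ?_
  have := coord_mul_dirichletDensity hα hβ hx i
  linear_combination h x * this

lemma integral_coord_pow {d : ℕ} {α : Fin d → ℝ} (hα : ∀ i, 1 ≤ α i) {β : ℝ} (hβ : 1 ≤ β)
    (i : Fin d) (k : ℕ) :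
    ∫ x in simplex d, x i ^ k * dirichletDensity α β x =
      ∏ m ∈ Finset.range k, (α i + m) / (∑ j, α j + β + m) := by
  induction k generalizing α with
  | zero => simp [integral_dirichletDensity hα hβ]
  | succ k ih =>
    simp only [pow_succ']
    rw [integral_coord_mul hα hβ (fun x => x i ^ k), ih (one_le_update hα i),
      Finset.prod_range_succ', mul_comm, Function.update_self, sum_update_add_one]
    simp only [Nat.cast_zero, add_zero, Nat.cast_succ]
    congr 1
    refine Finset.prod_congr rfl fun m _ => ?_
    congr 1 <;> ring

lemma integral_coord_mul_coord {d : ℕ} {α : Fin d → ℝ} (hα : ∀ i, 1 ≤ α i) {β : ℝ} (hβ : 1 ≤ β)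
    (i j : Fin d) :
    ∫ x in simplex d, x i * x j * dirichletDensity α β x =
      α i / (∑ j, α j + β) * ((α j + if i = j then 1 else 0) / (∑ j, α j + β + 1)) := by
  rw [integral_coord_mul hα hβ (fun x => x j)]
  have := integral_coord_pow (one_le_update hα i) hβ j 1
  simp only [pow_one, Finset.prod_range_one, Nat.cast_zero, add_zero] at this
  rw [this, sum_update_add_one, add_right_comm]
  rcases eq_or_ne i j with rfl | h
  · rw [Function.update_self, if_pos rfl]
  · rw [Function.update_of_ne h.symm, if_neg h, add_zero]

lemma kernel_params {d : ℕ} {b : ℝ} (hb : 0 < b) {s : Fin d → ℝ} (hs : s ∈ simplex d) :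
    (∀ i, 1 ≤ s i / b + 1) ∧ 1 ≤ (1 - l1norm s) / b + 1 ∧
      ∑ i, (s i / b + 1) + ((1 - l1norm s) / b + 1) = 1 / b + (d + 1) := by
  refine ⟨fun i => ?_, ?_, ?_⟩
  · have := div_nonneg (hs.1 i).1 hb.le
    linarith
  · have := div_nonneg (sub_nonneg.2 hs.2) hb.le
    linarith
  · rw [l1norm_of_mem hs, Finset.sum_add_distrib, ← Finset.sum_div]
    simp
    ring

lemma kernel_nonneg {d : ℕ} {b : ℝ} (hb : 0 < b) {s : Fin d → ℝ} (hs : s ∈ simplex d)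
    {x : Fin d → ℝ} (hx : x ∈ simplex d) : 0 ≤ kernel b s x :=
  dirichletDensity_nonneg (kernel_params hb hs).1 (kernel_params hb hs).2.1 hx

lemma continuous_kernel {d : ℕ} {b : ℝ} (hb : 0 < b) {s : Fin d → ℝ} (hs : s ∈ simplex d) :
    Continuous (kernel b s) :=
  continuous_dirichletDensity (kernel_params hb hs).1 (kernel_params hb hs).2.1

lemma integral_kernel {d : ℕ} {b : ℝ} (hb : 0 < b) {s : Fin d → ℝ} (hs : s ∈ simplex d) :
    ∫ x in simplex d, kernel b s x = 1 :=
  integral_dirichletDensity (kernel_params hb hs).1 (kernel_params hb hs).2.1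

lemma integrableOn_mul_kernel {d : ℕ} {b : ℝ} (hb : 0 < b) {s : Fin d → ℝ} (hs : s ∈ simplex d)
    {h : (Fin d → ℝ) → ℝ} (hh : ContinuousOn h (simplex d)) :
    IntegrableOn (fun x => h x * kernel b s x) (simplex d) :=
  integrableOn_simplex (hh.mul (continuous_kernel hb hs).continuousOn)

lemma integral_add_mul_kernel {d : ℕ} {b : ℝ} (hb : 0 < b) {s : Fin d → ℝ} (hs : s ∈ simplex d)
    {h₁ h₂ : (Fin d → ℝ) → ℝ} (hh₁ : ContinuousOn h₁ (simplex d))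
    (hh₂ : ContinuousOn h₂ (simplex d)) :
    ∫ x in simplex d, (h₁ x + h₂ x) * kernel b s x =
      (∫ x in simplex d, h₁ x * kernel b s x) + ∫ x in simplex d, h₂ x * kernel b s x := by
  simp only [add_mul]
  exact integral_add (integrableOn_mul_kernel hb hs hh₁) (integrableOn_mul_kernel hb hs hh₂)

lemma integral_const_mul_mul_kernel {d : ℕ} (b : ℝ) (s : Fin d → ℝ) (c : ℝ)
    (h : (Fin d → ℝ) → ℝ) :
    ∫ x in simplex d, c * h x * kernel b s x = c * ∫ x in simplex d, h x * kernel b s x := by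
  simp only [mul_assoc]
  exact integral_const_mul _ _

lemma integral_const_mul_kernel {d : ℕ} {b : ℝ} (hb : 0 < b) {s : Fin d → ℝ} (hs : s ∈ simplex d)
    (c : ℝ) : ∫ x in simplex d, c * kernel b s x = c := by
  rw [integral_const_mul, integral_kernel hb hs, mul_one]

lemma integral_sum_mul_kernel {d : ℕ} {b : ℝ} (hb : 0 < b) {s : Fin d → ℝ} (hs : s ∈ simplex d)
    {ι : Type*} (t : Finset ι) {h : ι → (Fin d → ℝ) → ℝ}
    (hh : ∀ i, ContinuousOn (h i) (simplex d)) :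
    ∫ x in simplex d, (∑ i ∈ t, h i x) * kernel b s x =
      ∑ i ∈ t, ∫ x in simplex d, h i x * kernel b s x := by
  simp only [Finset.sum_mul]
  exact integral_finsetSum _ fun i _ => integrableOn_mul_kernel hb hs (hh i)

lemma abs_integral_mul_kernel_le {d : ℕ} {b : ℝ} (hb : 0 < b) {s : Fin d → ℝ} (hs : s ∈ simplex d)
    {h₁ h₂ : (Fin d → ℝ) → ℝ} (hh₁ : ContinuousOn h₁ (simplex d))
    (hh₂ : ContinuousOn h₂ (simplex d)) (hle : ∀ x ∈ simplex d, |h₁ x| ≤ h₂ x) :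
    |∫ x in simplex d, h₁ x * kernel b s x| ≤ ∫ x in simplex d, h₂ x * kernel b s x := by
  refine (abs_integral_le_integral_abs).trans (setIntegral_mono_on
    (integrableOn_mul_kernel hb hs hh₁).abs (integrableOn_mul_kernel hb hs hh₂)
    (measurableSet_simplex d) fun x hx => ?_)
  rw [abs_mul, abs_of_nonneg (kernel_nonneg hb hs hx)]
  exact mul_le_mul_of_nonneg_right (hle x hx) (kernel_nonneg hb hs hx)

lemma kernel_moment {d : ℕ} {b : ℝ} (hb : 0 < b) {s : Fin d → ℝ} (hs : s ∈ simplex d)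
    (i : Fin d) (k : ℕ) :
    ∫ x in simplex d, x i ^ k * kernel b s x =
      ∏ m ∈ Finset.range k, (s i + (m + 1) * b) / (1 + (d + (m + 1)) * b) := by
  obtain ⟨h1, h2, h3⟩ := kernel_params hb hs
  rw [kernel, integral_coord_pow h1 h2, h3]
  refine Finset.prod_congr rfl fun m _ => ?_
  field_simp
  ring

lemma kernel_moment_pair {d : ℕ} {b : ℝ} (hb : 0 < b) {s : Fin d → ℝ} (hs : s ∈ simplex d)
    (i j : Fin d) :
    ∫ x in simplex d, x i * x j * kernel b s x =
      (s i + b) / (1 + (d + 1) * b) *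
        ((s j + b + if i = j then b else 0) / (1 + (d + 2) * b)) := by
  obtain ⟨h1, h2, h3⟩ := kernel_params hb hs
  rw [kernel, integral_coord_mul_coord h1 h2, h3]
  split_ifs <;> field_simp <;> ring

lemma mean_sub {d : ℕ} {b : ℝ} (hb : 0 < b) {s : Fin d → ℝ} (hs : s ∈ simplex d) (i : Fin d) :
    ∫ x in simplex d, (x i - s i) * kernel b s x =
      b * (1 - (d + 1) * s i) / (1 + (d + 1) * b) := by
  have m1 := kernel_moment hb hs i 1
  simp only [pow_one, Finset.prod_range_succ, Finset.prod_range_zero] at m1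
  simp only [sub_eq_add_neg]
  rw [integral_add_mul_kernel hb hs, m1, integral_const_mul_kernel hb hs]
  · push_cast
    field_simp
    ring
  all_goals fun_prop

lemma second_sub {d : ℕ} {b : ℝ} (hb : 0 < b) {s : Fin d → ℝ} (hs : s ∈ simplex d)
    (i j : Fin d) :
    ∫ x in simplex d, (x i - s i) * (x j - s j) * kernel b s x =
      (s i + b) / (1 + (d + 1) * b) *
        ((s j + b + if i = j then b else 0) / (1 + (d + 2) * b)) -
        s j * (s i + b) / (1 + (d + 1) * b) -
        s i * (s j + b) / (1 + (d + 1) * b) + s i * s j := by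
  have m1 := fun i => kernel_moment hb hs i 1
  simp only [pow_one, Finset.prod_range_succ, Finset.prod_range_zero] at m1
  have e : ∀ x : Fin d → ℝ, (x i - s i) * (x j - s j) =
      x i * x j + (-s j * x i + (-s i * x j + s i * s j)) := fun x => by ring
  simp only [e]
  rw [integral_add_mul_kernel hb hs, integral_add_mul_kernel hb hs, integral_add_mul_kernel hb hs,
    integral_const_mul_mul_kernel, integral_const_mul_mul_kernel, integral_const_mul_kernel hb hs,
    m1, m1, kernel_moment_pair hb hs]
  · push_cast
    ring
  all_goals fun_prop

lemma fourth_sub {d : ℕ} {b : ℝ} (hb : 0 < b) {s : Fin d → ℝ} (hs : s ∈ simplex d)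
    (i : Fin d) :
    ∫ x in simplex d, (x i - s i) ^ 4 * kernel b s x =
      (s i + b) * (s i + 2 * b) * (s i + 3 * b) * (s i + 4 * b) /
        ((1 + (d + 1) * b) * (1 + (d + 2) * b) * (1 + (d + 3) * b) * (1 + (d + 4) * b)) -
      4 * s i * ((s i + b) * (s i + 2 * b) * (s i + 3 * b) /
        ((1 + (d + 1) * b) * (1 + (d + 2) * b) * (1 + (d + 3) * b))) +
      6 * s i ^ 2 * ((s i + b) * (s i + 2 * b) /
        ((1 + (d + 1) * b) * (1 + (d + 2) * b))) -
      4 * s i ^ 3 * ((s i + b) / (1 + (d + 1) * b)) + s i ^ 4 := by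
  have m1 := kernel_moment hb hs i 1
  have m2 := kernel_moment hb hs i 2
  have m3 := kernel_moment hb hs i 3
  have m4 := kernel_moment hb hs i 4
  simp only [pow_one, Finset.prod_range_succ, Finset.prod_range_zero] at m1 m2 m3 m4
  have e : ∀ x : Fin d → ℝ, (x i - s i) ^ 4 = x i ^ 4 + (-4 * s i * x i ^ 3 +
      (6 * s i ^ 2 * x i ^ 2 + (-4 * s i ^ 3 * x i + s i ^ 4))) := fun x => by ring
  simp only [e]
  rw [integral_add_mul_kernel hb hs, integral_add_mul_kernel hb hs, integral_add_mul_kernel hb hs,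
    integral_add_mul_kernel hb hs, integral_const_mul_mul_kernel, integral_const_mul_mul_kernel,
    integral_const_mul_mul_kernel, integral_const_mul_kernel hb hs, m1, m2, m3, m4]
  · push_cast
    norm_num
    field_simp
    ring
  all_goals fun_prop

/-- A continuous function of two coordinates and a bandwidth is bounded on the unit cube. -/
lemma exists_bound_unitCube (Q : ℝ × ℝ × ℝ → ℝ) (hQ : Continuous Q) :
    ∃ C, 0 ≤ C ∧ ∀ x ∈ Set.Icc (0 : ℝ) 1, ∀ y ∈ Set.Icc (0 : ℝ) 1, ∀ z ∈ Set.Icc (0 : ℝ) 1,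
      |Q (x, y, z)| ≤ C := by
  obtain ⟨C, hC⟩ := ((isCompact_Icc (a := (0 : ℝ)) (b := 1)).prod
    ((isCompact_Icc (a := (0 : ℝ)) (b := 1)).prod
      (isCompact_Icc (a := (0 : ℝ)) (b := 1)))).exists_bound_of_continuousOn hQ.continuousOn
  exact ⟨max C 0, le_max_right _ _, fun x hx y hy z hz =>
    (hC (x, y, z) ⟨hx, hy, hz⟩).trans (le_max_left _ _)⟩

lemma abs_div_le_of_one_le {a c C : ℝ} (ha : |a| ≤ C) (hc : 1 ≤ c) : |a / c| ≤ C := by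
  rw [abs_div, abs_of_pos (by linarith : 0 < c)]
  exact (div_le_self (abs_nonneg _) hc).trans ha

lemma exists_mean_bound (d : ℕ) : ∃ C, 0 ≤ C ∧ ∀ b : ℝ, 0 < b → b ≤ 1 → ∀ s ∈ simplex d,
    ∀ i, |(∫ x in simplex d, (x i - s i) * kernel b s x) - b * (1 - (d + 1) * s i)| ≤
      C * b ^ 2 := by
  obtain ⟨C, hC0, hC⟩ := exists_bound_unitCube
    (fun p => ((d : ℝ) + 1) * (1 - (d + 1) * p.1)) (by fun_prop)
  refine ⟨C, hC0, fun b hb hb1 s hs i => ?_⟩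
  rw [mean_sub hb hs, show b * (1 - ((d : ℝ) + 1) * s i) / (1 + (d + 1) * b) -
    b * (1 - (d + 1) * s i) = b ^ 2 * (-((((d : ℝ) + 1) * (1 - (d + 1) * s i)) /
      (1 + (d + 1) * b))) by field_simp; ring, abs_mul, abs_of_pos (by positivity : 0 < b ^ 2),
    mul_comm, abs_neg]
  gcongr
  refine abs_div_le_of_one_le (hC (s i) (hs.1 i) b ⟨hb.le, hb1⟩ b ⟨hb.le, hb1⟩) ?_
  have : 0 ≤ ((d : ℝ) + 1) * b := by positivity
  linarith

lemma exists_second_bound (d : ℕ) : ∃ C, 0 ≤ C ∧ ∀ b : ℝ, 0 < b → b ≤ 1 → ∀ s ∈ simplex d,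
    ∀ i j, |(∫ x in simplex d, (x i - s i) * (x j - s j) * kernel b s x) -
      b * (s i * ((if i = j then 1 else 0) - s j))| ≤ C * b ^ 2 := by
  have hQ := fun δ : ℝ => exists_bound_unitCube
    (fun p => (1 + δ) - ((d : ℝ) + 2) * (p.1 + p.2.1) + (d + 1) * (d + 2) * p.1 * p.2.1 -
      p.1 * (δ - p.2.1) * (2 * (d + 1) + 1 + (d + 1) * (d + 2) * p.2.2)) (by fun_prop)
  obtain ⟨C₁, h₁0, h₁⟩ := hQ 1
  obtain ⟨C₀, h₀0, h₀⟩ := hQ 0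
  refine ⟨max C₁ C₀, le_max_of_le_left h₁0, fun b hb hb1 s hs i j => ?_⟩
  have hden : 1 ≤ (1 + ((d : ℝ) + 1) * b) * (1 + (d + 2) * b) := by
    have h1 : 0 ≤ ((d : ℝ) + 1) * b := by positivity
    have h2 : 0 ≤ ((d : ℝ) + 2) * b := by positivity
    nlinarith
  rw [second_sub hb hs]
  by_cases hij : i = j
  · rw [if_pos hij, if_pos hij]
    have := h₁ (s i) (hs.1 i) (s j) (hs.1 j) b ⟨hb.le, hb1⟩
    have e : (s i + b) / (1 + ((d : ℝ) + 1) * b) * ((s j + b + b) / (1 + (d + 2) * b)) -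
        s j * (s i + b) / (1 + (d + 1) * b) - s i * (s j + b) / (1 + (d + 1) * b) +
        s i * s j - b * (s i * (1 - s j)) = b ^ 2 * (((1 + 1) - ((d : ℝ) + 2) * (s i + s j) +
          (d + 1) * (d + 2) * s i * s j -
      s i * (1 - s j) * (2 * (d + 1) + 1 + (d + 1) * (d + 2) * b)) /
        ((1 + ((d : ℝ) + 1) * b) * (1 + (d + 2) * b))) := by
      subst hij
      field_simp
      ring
    rw [e, abs_mul, abs_of_pos (by positivity : 0 < b ^ 2), mul_comm]
    gcongr
    exact abs_div_le_of_one_le (this.trans (le_max_left _ _)) hden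
  · rw [if_neg hij, if_neg hij]
    have := h₀ (s i) (hs.1 i) (s j) (hs.1 j) b ⟨hb.le, hb1⟩
    have e : (s i + b) / (1 + ((d : ℝ) + 1) * b) * ((s j + b + 0) / (1 + (d + 2) * b)) -
        s j * (s i + b) / (1 + (d + 1) * b) - s i * (s j + b) / (1 + (d + 1) * b) +
        s i * s j - b * (s i * (0 - s j)) = b ^ 2 * (((1 + 0) - ((d : ℝ) + 2) * (s i + s j) +
          (d + 1) * (d + 2) * s i * s j -
      s i * (0 - s j) * (2 * (d + 1) + 1 + (d + 1) * (d + 2) * b)) /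
        ((1 + ((d : ℝ) + 1) * b) * (1 + (d + 2) * b))) := by
      field_simp
      ring
    rw [e, abs_mul, abs_of_pos (by positivity : 0 < b ^ 2), mul_comm]
    gcongr
    exact abs_div_le_of_one_le (this.trans (le_max_right _ _)) hden

lemma exists_square_bound (d : ℕ) : ∃ C, 0 ≤ C ∧ ∀ b : ℝ, 0 < b → b ≤ 1 → ∀ s ∈ simplex d,
    ∀ i, ∫ x in simplex d, (x i - s i) ^ 2 * kernel b s x ≤ C * b := by
  obtain ⟨C, hC0, hC⟩ := exists_second_bound d
  refine ⟨C + 1, by linarith, fun b hb hb1 s hs i => ?_⟩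
  have h := (abs_le.1 (hC b hb hb1 s hs i i)).2
  simp only [if_true, ← pow_two] at h
  obtain ⟨h0, h1⟩ := hs.1 i
  have h2 : b * (s i * (1 - s i)) ≤ b * 1 := by gcongr; nlinarith
  have h3 : C * b ^ 2 ≤ C * b := by gcongr; nlinarith
  linarith

lemma exists_fourth_bound (d : ℕ) : ∃ C, 0 ≤ C ∧ ∀ b : ℝ, 0 < b → b ≤ 1 → ∀ s ∈ simplex d,
    ∀ i, ∫ x in simplex d, (x i - s i) ^ 4 * kernel b s x ≤ C * b ^ 2 := by
  let Q : ℝ → ℝ → ℝ → ℝ := fun s b D => 24*b^2 + 26*s*b - 72*s*b^2 - 24*s*b^2*D + 3*s^2 -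
    72*s^2*b - 20*s^2*b*D + 72*s^2*b^2 + 60*s^2*b^2*D + 12*s^2*b^2*D^2 - 6*s^3 + 64*s^3*b +
    42*s^3*b*D + 6*s^3*b*D^2 - 24*s^3*b^2 - 44*s^3*b^2*D - 24*s^3*b^2*D^2 - 4*s^3*b^2*D^3 +
    3*s^4 - 18*s^4*b - 22*s^4*b*D - 6*s^4*b*D^2 + 6*s^4*b^2*D + 11*s^4*b^2*D^2 +
    6*s^4*b^2*D^3 + s^4*b^2*D^4
  obtain ⟨C, hC0, hC⟩ := exists_bound_unitCube (fun p => Q p.1 p.2.2 (d + 1))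
    (by simp only [Q]; fun_prop)
  refine ⟨C, hC0, fun b hb hb1 s hs i => ?_⟩
  have h1 : 0 ≤ ((d : ℝ) + 1) * b := by positivity
  have h2 : 0 ≤ ((d : ℝ) + 2) * b := by positivity
  have h3 : 0 ≤ ((d : ℝ) + 3) * b := by positivity
  have h4 : 0 ≤ ((d : ℝ) + 4) * b := by positivity
  have hden : 1 ≤ (1 + ((d : ℝ) + 1) * b) * (1 + (d + 2) * b) * (1 + (d + 3) * b) *
      (1 + (d + 4) * b) :=
    one_le_mul_of_one_le_of_one_le (one_le_mul_of_one_le_of_one_le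
      (one_le_mul_of_one_le_of_one_le (by linarith) (by linarith)) (by linarith)) (by linarith)
  rw [fourth_sub hb hs]
  have e : (s i + b) * (s i + 2 * b) * (s i + 3 * b) * (s i + 4 * b) /
        ((1 + ((d : ℝ) + 1) * b) * (1 + (d + 2) * b) * (1 + (d + 3) * b) * (1 + (d + 4) * b)) -
      4 * s i * ((s i + b) * (s i + 2 * b) * (s i + 3 * b) /
        ((1 + (d + 1) * b) * (1 + (d + 2) * b) * (1 + (d + 3) * b))) +
      6 * s i ^ 2 * ((s i + b) * (s i + 2 * b) /
        ((1 + (d + 1) * b) * (1 + (d + 2) * b))) -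
      4 * s i ^ 3 * ((s i + b) / (1 + (d + 1) * b)) + s i ^ 4 =
      b ^ 2 * (Q (s i) b (d + 1) / ((1 + ((d : ℝ) + 1) * b) * (1 + (d + 2) * b) *
        (1 + (d + 3) * b) * (1 + (d + 4) * b))) := by
    simp only [Q]
    field_simp
    ring
  rw [e, mul_comm]
  gcongr
  exact (le_abs_self _).trans (abs_div_le_of_one_le
    (hC (s i) (hs.1 i) b ⟨hb.le, hb1⟩ b ⟨hb.le, hb1⟩) hden)

lemma uniqueDiffOn_simplex (d : ℕ) : UniqueDiffOn ℝ (simplex d) := by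
  refine uniqueDiffOn_convex (convex_simplex d) ?_
  have ho : IsOpen {x : Fin d → ℝ | (∀ i, 0 < x i) ∧ ∑ i, x i < 1} := by
    simp only [Set.ofPred_and, Set.ofPred_forall]
    exact (isOpen_iInter_of_finite fun i => isOpen_lt continuous_const (continuous_apply i)).inter
      (isOpen_lt (by fun_prop) continuous_const)
  refine ⟨fun _ => 1 / (d + 1), interior_maximal (fun x hx => ?_) ho ⟨fun i => by positivity, ?_⟩⟩
  · exact mem_simplex_iff.2 ⟨fun i => (hx.1 i).le, hx.2.le⟩
  · rw [Finset.sum_const, Finset.card_univ, Fintype.card_fin, nsmul_eq_mul, mul_one_div,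
      div_lt_one (by positivity)]
    linarith

/-- Second-order Taylor bound along a segment of a convex set. -/
lemma abs_taylor_two_le {E : Type*} [NormedAddCommGroup E] [NormedSpace ℝ E] {S : Set E}
    (hS : Convex ℝ S) {f : E → ℝ} {F₁ : E → E →L[ℝ] ℝ} {F₂ : E → E →L[ℝ] E →L[ℝ] ℝ}
    (h₁ : ∀ y ∈ S, HasFDerivWithinAt f (F₁ y) S y)
    (h₂ : ∀ y ∈ S, HasFDerivWithinAt F₁ (F₂ y) S y) {s x : E} (hs : s ∈ S) (hx : x ∈ S) {η : ℝ}
    (hη : ∀ y ∈ S, ‖y - s‖ ≤ ‖x - s‖ → ‖F₂ y - F₂ s‖ ≤ η) :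
    |f x - f s - F₁ s (x - s) - 1 / 2 * F₂ s (x - s) (x - s)| ≤ η * ‖x - s‖ ^ 2 := by
  set v := x - s with hv
  have hγS : Set.MapsTo (fun t : ℝ => s + t • v) (Set.Icc 0 1) S := fun t ht =>
    hS.add_smul_sub_mem hs hx ht
  have hγ : ∀ t : ℝ, HasDerivWithinAt (fun t : ℝ => s + t • v) v (Set.Icc 0 1) t := fun t => by
    simpa using (((hasDerivAt_id t).smul_const v).const_add s).hasDerivWithinAt
  have h1 : ∀ t ∈ Set.Icc (0 : ℝ) 1,
      |F₁ (s + t • v) v - F₁ s v - t * F₂ s v v| ≤ η * ‖v‖ ^ 2 := by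
    intro t ht
    have hd : ∀ u ∈ Set.Icc (0 : ℝ) 1, HasDerivWithinAt
        (fun u : ℝ => F₁ (s + u • v) v - F₁ s v - u * F₂ s v v)
        (F₂ (s + u • v) v v - F₂ s v v) (Set.Icc 0 1) u := fun u hu => by
      have e : HasDerivWithinAt (fun u : ℝ => F₁ (s + u • v) v) (F₂ (s + u • v) v v)
          (Set.Icc 0 1) u :=
        (ContinuousLinearMap.apply ℝ ℝ v).hasFDerivAt.comp_hasDerivWithinAt u
          ((h₂ _ (hγS hu)).comp_hasDerivWithinAt u (hγ u) hγS)
      refine ((e.sub_const (F₁ s v)).sub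
        ((hasDerivAt_id u).mul_const (F₂ s v v)).hasDerivWithinAt).congr_deriv ?_
      rw [one_mul]
    have hb : ∀ u ∈ Set.Icc (0 : ℝ) 1, ‖F₂ (s + u • v) v v - F₂ s v v‖ ≤ η * ‖v‖ ^ 2 := by
      intro u hu
      have hn : ‖F₂ (s + u • v) - F₂ s‖ ≤ η := by
        refine hη _ (hγS hu) ?_
        rw [add_sub_cancel_left, norm_smul, Real.norm_of_nonneg hu.1]
        exact mul_le_of_le_one_left (norm_nonneg _) hu.2
      calc ‖F₂ (s + u • v) v v - F₂ s v v‖ = ‖(F₂ (s + u • v) - F₂ s) v v‖ := by simp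
        _ ≤ ‖F₂ (s + u • v) - F₂ s‖ * ‖v‖ * ‖v‖ := ContinuousLinearMap.le_opNorm₂ _ _ _
        _ ≤ η * ‖v‖ * ‖v‖ := by gcongr
        _ = η * ‖v‖ ^ 2 := by ring
    have := (convex_Icc (0 : ℝ) 1).norm_image_sub_le_of_norm_hasDerivWithin_le hd hb
      (Set.left_mem_Icc.2 zero_le_one) ht
    simp only [zero_smul, add_zero, sub_self, zero_mul, sub_zero, Real.norm_eq_abs,
      abs_of_nonneg ht.1] at this
    refine this.trans (mul_le_of_le_one_right ?_ ht.2)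
    exact (norm_nonneg _).trans (hb t ht)
  have hd : ∀ t ∈ Set.Icc (0 : ℝ) 1, HasDerivWithinAt
      (fun t : ℝ => f (s + t • v) - f s - t * F₁ s v - t ^ 2 * (1 / 2 * F₂ s v v))
      (F₁ (s + t • v) v - F₁ s v - t * F₂ s v v) (Set.Icc 0 1) t := fun t ht => by
    have e := ((h₁ _ (hγS ht)).comp_hasDerivWithinAt t (hγ t) hγS)
    have := ((e.sub_const (f s)).sub ((hasDerivAt_id t).mul_const (F₁ s v)).hasDerivWithinAt).sub
      ((hasDerivAt_pow 2 t).mul_const (1 / 2 * F₂ s v v)).hasDerivWithinAt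
    refine this.congr_deriv ?_
    simp
    ring
  have := (convex_Icc (0 : ℝ) 1).norm_image_sub_le_of_norm_hasDerivWithin_le hd h1
    (Set.left_mem_Icc.2 zero_le_one) (Set.right_mem_Icc.2 zero_le_one)
  simpa [hv, add_sub_cancel] using this

lemma exists_taylor_bound {E : Type*} [NormedAddCommGroup E] [NormedSpace ℝ E] {S : Set E}
    (hS : Convex ℝ S) (hc : IsCompact S) {f : E → ℝ} {F₁ : E → E →L[ℝ] ℝ}
    {F₂ : E → E →L[ℝ] E →L[ℝ] ℝ}
    (h₁ : ∀ y ∈ S, HasFDerivWithinAt f (F₁ y) S y)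
    (h₂ : ∀ y ∈ S, HasFDerivWithinAt F₁ (F₂ y) S y) (h₃ : ContinuousOn F₂ S) {ε : ℝ} (hε : 0 < ε) :
    ∃ C, 0 ≤ C ∧ ∀ s ∈ S, ∀ x ∈ S,
      |f x - f s - F₁ s (x - s) - 1 / 2 * F₂ s (x - s) (x - s)| ≤
        ε * ‖x - s‖ ^ 2 + C * ‖x - s‖ ^ 4 := by
  obtain ⟨M, hM⟩ : ∃ M, ∀ y ∈ S, ‖F₂ y‖ ≤ M := hc.exists_bound_of_continuousOn (f := F₂) h₃
  obtain ⟨δ, hδ, hu⟩ := Metric.uniformContinuousOn_iff (f := F₂) (s := S)|>.1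
    (hc.uniformContinuousOn_of_continuous (f := F₂) h₃) ε hε
  refine ⟨2 * |M| / δ ^ 2, by positivity, fun s hs x hx => ?_⟩
  rcases lt_or_ge ‖x - s‖ δ with h | h
  · refine (abs_taylor_two_le hS h₁ h₂ hs hx (η := ε) fun y hy hys => ?_).trans
      (le_add_of_nonneg_right (by positivity))
    exact ((dist_eq_norm (F₂ y) (F₂ s)).symm.trans_lt
      (hu y hy s hs (by rw [dist_eq_norm]; exact hys.trans_lt h))).le
  · refine (abs_taylor_two_le hS h₁ h₂ hs hx (η := 2 * |M|) fun y hy hys => ?_).trans ?_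
    · have := norm_sub_le (F₂ y) (F₂ s)
      linarith [hM y hy, hM s hs, le_abs_self M]
    · have : 2 * |M| * ‖x - s‖ ^ 2 ≤ 2 * |M| / δ ^ 2 * ‖x - s‖ ^ 4 := by
        rw [div_mul_eq_mul_div, le_div_iff₀ (by positivity), mul_assoc]
        gcongr
        rw [show ‖x - s‖ ^ 4 = ‖x - s‖ ^ 2 * ‖x - s‖ ^ 2 by ring]
        gcongr
      have : 0 ≤ ε * ‖x - s‖ ^ 2 := by positivity
      linarith

lemma norm_pow_le_sum {d : ℕ} (v : Fin d → ℝ) {k : ℕ} (hk : Even k) (hk0 : k ≠ 0) :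
    ‖v‖ ^ k ≤ ∑ i, v i ^ k := by
  have hn : ∀ i ∈ Finset.univ, 0 ≤ v i ^ k := fun i _ => hk.pow_nonneg _
  rcases isEmpty_or_nonempty (Fin d) with h | h
  · simp [Subsingleton.elim v 0, hk0]
  · obtain ⟨i, hi⟩ := exists_eq_ciSup_of_finite (f := fun i => ‖v i‖)
    have : ‖v‖ = ‖v i‖ := le_antisymm
      ((pi_norm_le_iff_of_nonneg (norm_nonneg _)).2 fun j => by
        rw [hi]
        exact le_ciSup (f := fun i => ‖v i‖) (Set.finite_range _).bddAbove j) (norm_le_pi_norm v i)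
    rw [this, Real.norm_eq_abs, hk.pow_abs]
    exact Finset.single_le_sum hn (Finset.mem_univ i)

lemma sum_smul_single {d : ℕ} (v : Fin d → ℝ) : v = ∑ i, v i • Pi.single (M := fun _ => ℝ) i 1 := by
  ext j
  simp [Finset.sum_apply, Pi.single_apply]

lemma clm_apply_eq_sum {d : ℕ} {G : Type*} [NormedAddCommGroup G] [NormedSpace ℝ G]
    (A : (Fin d → ℝ) →L[ℝ] G) (v : Fin d → ℝ) :
    A v = ∑ i, v i • A (Pi.single i 1) := by
  conv_lhs => rw [sum_smul_single v]
  simp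

lemma norm_single_one_le {d : ℕ} (i : Fin d) : ‖(Pi.single i 1 : Fin d → ℝ)‖ ≤ 1 := by
  refine (pi_norm_le_iff_of_nonneg zero_le_one).2 fun j => ?_
  rw [Pi.single_apply]
  split_ifs <;> simp

lemma div_mul_le_half {ε x : ℝ} (hε : 0 ≤ ε) (hx : 0 ≤ x) : ε / (2 * (x + 1)) * x ≤ ε / 2 := by
  rw [div_mul_eq_mul_div, div_le_div_iff₀ (by positivity) (by norm_num)]
  nlinarith

set_option maxHeartbeats 1000000 in
lemma exists_smoothed_bias {d : ℕ} {f : (Fin d → ℝ) → ℝ} (hf : ContDiffOn ℝ 2 f (simplex d))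
    {ε : ℝ} (hε : 0 < ε) : ∃ b₀ : ℝ, 0 < b₀ ∧ ∀ b : ℝ, 0 < b → b < b₀ → ∀ s ∈ simplex d,
      |smoothed f b s - f s - b * biasTerm f s| ≤ ε * b := by
  set S := simplex d
  have hU : UniqueDiffOn ℝ S := uniqueDiffOn_simplex d
  set F₁ := fderivWithin ℝ f S
  set F₂ := fderivWithin ℝ F₁ S
  have c₁ : ContDiffOn ℝ 1 F₁ S := hf.fderivWithin hU (by norm_num)
  have c₂ : ContinuousOn F₂ S := c₁.continuousOn_fderivWithin hU le_rfl
  have h₁ : ∀ y ∈ S, HasFDerivWithinAt f (F₁ y) S y := fun y hy =>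
    (hf.differentiableOn (by norm_num) y hy).hasFDerivWithinAt
  have h₂ : ∀ y ∈ S, HasFDerivWithinAt F₁ (F₂ y) S y := fun y hy =>
    (c₁.differentiableOn (by norm_num) y hy).hasFDerivWithinAt
  have hp : ∀ s ∈ S, ∀ i j, partialDeriv i (partialDeriv j f) s =
      F₂ s (Pi.single i 1) (Pi.single j 1) := fun s hs i j => by
    have e : HasFDerivWithinAt (partialDeriv j f) ((F₂ s).flip (Pi.single j 1)) S s := by
      exact (ContinuousLinearMap.apply ℝ ℝ (Pi.single j (1 : ℝ))).hasFDerivAt.comp_hasFDerivWithinAt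
        s (h₂ s hs)
    rw [partialDeriv, e.fderivWithin (hU s hs), ContinuousLinearMap.flip_apply]
  obtain ⟨K₁, hK₁⟩ : ∃ K, ∀ y ∈ S, ‖F₁ y‖ ≤ K :=
    (isCompact_simplex d).exists_bound_of_continuousOn (f := F₁) c₁.continuousOn
  obtain ⟨K₂, hK₂⟩ : ∃ K, ∀ y ∈ S, ‖F₂ y‖ ≤ K :=
    (isCompact_simplex d).exists_bound_of_continuousOn (f := F₂) c₂
  obtain ⟨C₁, hC₁0, hC₁⟩ := exists_mean_bound d
  obtain ⟨C₂, hC₂0, hC₂⟩ := exists_second_bound d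
  obtain ⟨C₃, hC₃0, hC₃⟩ := exists_square_bound d
  obtain ⟨C₄, hC₄0, hC₄⟩ := exists_fourth_bound d
  obtain ⟨C, hC0, hC⟩ := exists_taylor_bound (convex_simplex d) (isCompact_simplex d) h₁ h₂ c₂
    (ε := ε / (2 * (d * C₃ + 1))) (by positivity)
  set ε' := ε / (2 * (d * C₃ + 1)) with hε'
  have hε'0 : 0 < ε' := by positivity
  set K := d * (|K₁| * C₁) + d * d * (|K₂| * C₂) + C * (d * C₄) with hK
  have hK0 : 0 ≤ K := by positivity
  refine ⟨min 1 (ε / (2 * (K + 1))), by positivity, fun b hb hbb s hs => ?_⟩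
  have hb1 : b ≤ 1 := hbb.le.trans (min_le_left _ _)
  have hbK : b ≤ ε / (2 * (K + 1)) := hbb.le.trans (min_le_right _ _)
  set a : Fin d → ℝ := fun i => F₁ s (Pi.single i 1) with ha
  set c : Fin d → Fin d → ℝ := fun i j => F₂ s (Pi.single i 1) (Pi.single j 1) with hc
  have ha_le : ∀ i, |a i| ≤ |K₁| := fun i => by
    have := (F₁ s).le_opNorm_of_le (norm_single_one_le i)
    rw [mul_one] at this
    exact (this.trans (hK₁ s hs)).trans (le_abs_self _)
  have hc_le : ∀ i j, |c i j| ≤ |K₂| := fun i j => by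
    have h1 := (F₂ s).le_opNorm_of_le (norm_single_one_le i)
    have := (F₂ s (Pi.single i 1)).le_opNorm_of_le (norm_single_one_le j)
    rw [mul_one] at this h1
    exact (this.trans (h1.trans (hK₂ s hs))).trans (le_abs_self _)
  set P : (Fin d → ℝ) → ℝ := fun x => (∑ i, a i * (x i - s i)) +
    ∑ i, ∑ j, (1 / 2 * c i j) * ((x i - s i) * (x j - s j)) with hP
  have hPe : ∀ x, F₁ s (x - s) + 1 / 2 * F₂ s (x - s) (x - s) = P x := fun x => by
    rw [clm_apply_eq_sum (F₁ s), clm_apply_eq_sum (F₂ s), _root_.sum_apply,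
      Finset.mul_sum, hP]
    congr 1
    · exact Finset.sum_congr rfl fun i _ => by simp [ha, mul_comm]
    · refine Finset.sum_congr rfl fun i _ => ?_
      rw [_root_.smul_apply, clm_apply_eq_sum (F₂ s (Pi.single i 1)),
        Finset.smul_sum, Finset.mul_sum]
      refine Finset.sum_congr rfl fun j _ => ?_
      simp only [hc, Pi.sub_apply, smul_eq_mul]
      ring
  have hPc : ContinuousOn P S := by simp only [hP]; fun_prop
  set M : Fin d → ℝ := fun i => ∫ x in S, (x i - s i) * kernel b s x
  set V : Fin d → Fin d → ℝ := fun i j => ∫ x in S, (x i - s i) * (x j - s j) * kernel b s x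
  have hPint : ∫ x in S, P x * kernel b s x =
      ∑ i, a i * M i + ∑ i, ∑ j, (1 / 2 * c i j) * V i j := by
    simp only [hP]
    rw [integral_add_mul_kernel hb hs (by fun_prop) (by fun_prop),
      integral_sum_mul_kernel hb hs _ (fun i => by fun_prop),
      integral_sum_mul_kernel hb hs _ (fun i => by fun_prop)]
    congr 1
    · exact Finset.sum_congr rfl fun i _ => integral_const_mul_mul_kernel _ _ _ _
    · refine Finset.sum_congr rfl fun i _ => ?_
      rw [integral_sum_mul_kernel hb hs _ (fun i => by fun_prop)]
      exact Finset.sum_congr rfl fun j _ => integral_const_mul_mul_kernel _ _ _ _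
  have hr : |∫ x in S, (f x + (-f s + -1 * P x)) * kernel b s x| ≤
      ε' * (d * (C₃ * b)) + C * (d * (C₄ * b ^ 2)) := by
    refine (abs_integral_mul_kernel_le hb hs (h₁ := fun x => f x + (-f s + -1 * P x)) (h₂ := fun x => ε' * ∑ i, (x i - s i) ^ 2 +
      C * ∑ i, (x i - s i) ^ 4) (hf.continuousOn.add (by fun_prop)) (by fun_prop)
      fun x hx => ?_).trans ?_
    · have := hC s hs x hx
      have e := hPe x
      rw [show f x + (-f s + -1 * P x) = f x - f s - F₁ s (x - s) -
        1 / 2 * F₂ s (x - s) (x - s) by linarith]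
      refine this.trans ?_
      gcongr
      · exact norm_pow_le_sum (x - s) (by decide) (by norm_num)
      · exact norm_pow_le_sum (x - s) (by decide) (by norm_num)
    · rw [integral_add_mul_kernel hb hs (by fun_prop) (by fun_prop),
        integral_const_mul_mul_kernel, integral_const_mul_mul_kernel,
        integral_sum_mul_kernel hb hs _ (fun i => by fun_prop),
        integral_sum_mul_kernel hb hs _ (fun i => by fun_prop)]
      gcongr
      · refine (Finset.sum_le_sum fun i _ => hC₃ b hb hb1 s hs i).trans ?_
        simp
      · refine (Finset.sum_le_sum fun i _ => hC₄ b hb hb1 s hs i).trans ?_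
        simp
  have hrint : ∫ x in S, (f x + (-f s + -1 * P x)) * kernel b s x =
      smoothed f b s - f s - (∑ i, a i * M i + ∑ i, ∑ j, (1 / 2 * c i j) * V i j) := by
    rw [integral_add_mul_kernel hb hs hf.continuousOn (by fun_prop),
      integral_add_mul_kernel hb hs (by fun_prop) (by fun_prop), integral_const_mul_mul_kernel,
      integral_const_mul_kernel hb hs, hPint, smoothed]
    ring
  rw [hrint] at hr
  have hb_eq : b * biasTerm f s = ∑ i, a i * (b * (1 - (d + 1) * s i)) +
      ∑ i, ∑ j, (1 / 2 * c i j) * (b * (s i * ((if i = j then 1 else 0) - s j))) := by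
    rw [biasTerm, mul_add, Finset.mul_sum, Finset.mul_sum, Finset.mul_sum]
    congr 1
    · exact Finset.sum_congr rfl fun i _ => by simp only [partialDeriv, ha]; ring
    · refine Finset.sum_congr rfl fun i _ => ?_
      rw [Finset.mul_sum, Finset.mul_sum]
      refine Finset.sum_congr rfl fun j _ => ?_
      rw [hp s hs]
      ring
  have hdiff : |(∑ i, a i * M i + ∑ i, ∑ j, (1 / 2 * c i j) * V i j) - b * biasTerm f s| ≤
      d * (|K₁| * (C₁ * b ^ 2)) + d * (d * (|K₂| * (C₂ * b ^ 2))) := by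
    rw [hb_eq, add_sub_add_comm, ← Finset.sum_sub_distrib, ← Finset.sum_sub_distrib]
    refine (abs_add_le _ _).trans (add_le_add ?_ ?_)
    · refine (Finset.abs_sum_le_sum_abs _ _).trans
        ((Finset.sum_le_card_nsmul _ _ (|K₁| * (C₁ * b ^ 2)) fun i _ => ?_).trans (by simp))
      rw [← mul_sub, abs_mul]
      exact mul_le_mul (ha_le i) (hC₁ b hb hb1 s hs i) (abs_nonneg _) (abs_nonneg _)
    · refine (Finset.abs_sum_le_sum_abs _ _).trans
        ((Finset.sum_le_card_nsmul _ _ (d * (|K₂| * (C₂ * b ^ 2))) fun i _ => ?_).trans (by simp))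
      rw [← Finset.sum_sub_distrib]
      refine (Finset.abs_sum_le_sum_abs _ _).trans
        ((Finset.sum_le_card_nsmul _ _ (|K₂| * (C₂ * b ^ 2)) fun j _ => ?_).trans (by simp))
      rw [← mul_sub, abs_mul]
      refine mul_le_mul ?_ (hC₂ b hb hb1 s hs i j) (abs_nonneg _) (abs_nonneg _)
      rw [abs_mul, abs_of_pos (by norm_num : (0 : ℝ) < 1 / 2)]
      linarith [hc_le i j, abs_nonneg (c i j)]
  have htri := abs_add_le (smoothed f b s - f s -
    (∑ i, a i * M i + ∑ i, ∑ j, (1 / 2 * c i j) * V i j))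
    ((∑ i, a i * M i + ∑ i, ∑ j, (1 / 2 * c i j) * V i j) - b * biasTerm f s)
  rw [sub_add_sub_cancel] at htri
  have f1 : ε' * (d * C₃) ≤ ε / 2 := by
    exact div_mul_le_half hε.le (by positivity)
  have f2 : b * K ≤ ε / 2 := by
    calc b * K ≤ ε / (2 * (K + 1)) * K := by gcongr
      _ ≤ ε / 2 := div_mul_le_half hε.le hK0
  calc _ ≤ _ := htri.trans (add_le_add hr hdiff)
    _ = ε' * (d * C₃) * b + b * K * b := by rw [hK]; ring
    _ ≤ ε / 2 * b + ε / 2 * b := by gcongr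
    _ = ε * b := by ring

/-- `Γ(2u + 1) / (2^{2u} Γ(u + 1)²)`, a real interpolation of the central binomial probabilities. -/
noncomputable def gammaQuot (u : ℝ) : ℝ :=
  Real.Gamma (2 * u + 1) / ((2 : ℝ) ^ (2 * u) * Real.Gamma (u + 1) ^ 2)

lemma gammaQuot_eq_two_mul_gammaRatio (u : ℝ) : gammaQuot u = 2 * gammaRatio u := by
  rw [gammaQuot, gammaRatio, Real.rpow_add_one (by norm_num)]
  ring

lemma gammaQuot_pos {u : ℝ} (hu : 0 ≤ u) : 0 < gammaQuot u := by
  have h1 : 0 < Real.Gamma (2 * u + 1) := Real.Gamma_pos_of_pos (by linarith)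
  have h2 : 0 < Real.Gamma (u + 1) := Real.Gamma_pos_of_pos (by linarith)
  unfold gammaQuot
  positivity

lemma gammaQuot_eq {u : ℝ} (hu : 0 ≤ u) :
    gammaQuot u = Real.Gamma (u + 1 / 2) / (√Real.pi * Real.Gamma (u + 1)) := by
  have h2 : 0 < Real.Gamma (u + 1) := Real.Gamma_pos_of_pos (by linarith)
  have h := Real.Gamma_mul_Gamma_add_half (u + 1 / 2)
  rw [show u + 1 / 2 + 1 / 2 = u + 1 by ring, show 2 * (u + 1 / 2) = 2 * u + 1 by ring,
    show 1 - (2 * u + 1) = -(2 * u) by ring, Real.rpow_neg (by norm_num)] at h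
  have h3 : (0 : ℝ) < 2 ^ (2 * u) := by positivity
  have h4 : 0 < √Real.pi := Real.sqrt_pos.2 Real.pi_pos
  rw [gammaQuot, div_eq_div_iff (by positivity) (by positivity)]
  have h5 : Real.Gamma (2 * u + 1) * √Real.pi =
      Real.Gamma (u + 1 / 2) * Real.Gamma (u + 1) * 2 ^ (2 * u) := by
    rw [h]
    field_simp
  linear_combination Real.Gamma (u + 1) * h5

lemma Gamma_add_half_sq_le {u : ℝ} (hu : 0 < u) :
    Real.Gamma (u + 1 / 2) ^ 2 ≤ Real.Gamma u * Real.Gamma (u + 1) := by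
  have h := Real.Gamma_mul_add_mul_le_rpow_Gamma_mul_rpow_Gamma hu (by linarith : 0 < u + 1)
    (by norm_num : (0 : ℝ) < 1 / 2) (by norm_num : (0 : ℝ) < 1 / 2) (by norm_num)
  rw [show 1 / 2 * u + 1 / 2 * (u + 1) = u + 1 / 2 by ring] at h
  have h1 : 0 < Real.Gamma u := Real.Gamma_pos_of_pos hu
  have h2 : 0 < Real.Gamma (u + 1) := Real.Gamma_pos_of_pos (by linarith)
  have h3 : 0 < Real.Gamma (u + 1 / 2) := Real.Gamma_pos_of_pos (by linarith)
  rw [← Real.sqrt_eq_rpow, ← Real.sqrt_eq_rpow] at h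
  calc Real.Gamma (u + 1 / 2) ^ 2 ≤ (√(Real.Gamma u) * √(Real.Gamma (u + 1))) ^ 2 := by gcongr
    _ = _ := by rw [mul_pow, Real.sq_sqrt h1.le, Real.sq_sqrt h2.le]

/-- The ratio of `gammaQuot u` to its asymptotic equivalent `(π u)^{-1/2}`. -/
noncomputable def gammaQuotRel (u : ℝ) : ℝ := √(Real.pi * u) * gammaQuot u

lemma gammaQuotRel_sq {u : ℝ} (hu : 0 < u) :
    gammaQuotRel u ^ 2 = u * Real.Gamma (u + 1 / 2) ^ 2 / Real.Gamma (u + 1) ^ 2 := by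
  have h2 : 0 < Real.Gamma (u + 1) := Real.Gamma_pos_of_pos (by linarith)
  have hpi := Real.pi_pos
  rw [gammaQuotRel, gammaQuot_eq hu.le, mul_pow, Real.sq_sqrt (by positivity), div_pow, mul_pow,
    Real.sq_sqrt hpi.le]
  field_simp

lemma gammaQuotRel_le_one {u : ℝ} (hu : 0 < u) : gammaQuotRel u ≤ 1 := by
  have h := Gamma_add_half_sq_le hu
  have h2 : 0 < Real.Gamma (u + 1) := Real.Gamma_pos_of_pos (by linarith)
  refine le_of_sq_le_sq ?_ zero_le_one
  rw [gammaQuotRel_sq hu, one_pow, div_le_one (by positivity)]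
  have e := Real.Gamma_add_one hu.ne'
  calc u * Real.Gamma (u + 1 / 2) ^ 2 ≤ u * (Real.Gamma u * Real.Gamma (u + 1)) := by gcongr
    _ = Real.Gamma (u + 1) ^ 2 := by rw [e]; ring

lemma one_sub_le_gammaQuotRel {u : ℝ} (hu : 0 < u) : 1 - 1 / (2 * u) ≤ gammaQuotRel u := by
  have h := Gamma_add_half_sq_le (by linarith : 0 < u + 1 / 2)
  have e := Real.Gamma_add_one (by linarith : u + 1 / 2 ≠ 0)
  rw [e, show u + 1 / 2 + 1 / 2 = u + 1 by ring] at h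
  have h2 : 0 < Real.Gamma (u + 1) := Real.Gamma_pos_of_pos (by linarith)
  have h0 : 0 ≤ gammaQuotRel u := mul_nonneg (Real.sqrt_nonneg _) (gammaQuot_pos hu.le).le
  have h1 : u / (u + 1 / 2) ≤ gammaQuotRel u ^ 2 := by
    rw [gammaQuotRel_sq hu, div_le_div_iff₀ (by positivity) (by positivity)]
    calc u * Real.Gamma (u + 1) ^ 2 ≤
        u * (Real.Gamma (u + 1 / 2) * ((u + 1 / 2) * Real.Gamma (u + 1 / 2))) := by gcongr
      _ = _ := by ring
  have h3 : gammaQuotRel u ^ 2 ≤ gammaQuotRel u := by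
    nlinarith [gammaQuotRel_le_one hu]
  have h4 : 1 - 1 / (2 * u) ≤ u / (u + 1 / 2) := by
    rw [le_div_iff₀ (by positivity)]
    have : (1 - 1 / (2 * u)) * (u + 1 / 2) = u - 1 / (4 * u) := by field_simp; ring
    rw [this]
    have : 0 < 1 / (4 * u) := by positivity
    linarith
  linarith

lemma abs_gammaQuotRel_sub_one_le {u : ℝ} (hu : 0 < u) : |gammaQuotRel u - 1| ≤ 1 / (2 * u) := by
  rw [abs_le]
  have h1 := one_sub_le_gammaQuotRel hu
  have h2 := gammaQuotRel_le_one hu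
  have h3 : 0 < 1 / (2 * u) := by positivity
  constructor <;> linarith

lemma abs_mul_sub_one_le (x y : ℝ) : |x * y - 1| ≤ |x - 1| * |y| + |y - 1| := by
  rw [← abs_mul]
  refine le_trans (le_of_eq ?_) (abs_add_le _ _)
  congr 1
  ring

/-- The dimension-dependent factor in the squared Dirichlet kernel. -/
noncomputable def totalFactor (d : ℕ) (N : ℝ) : ℝ :=
  Real.Gamma (N + (d + 1)) ^ 2 * 2 ^ (2 * N) / Real.Gamma (2 * N + (d + 1))

lemma totalFactor_succ (d : ℕ) {N : ℝ} (hN : 0 < N) :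
    totalFactor (d + 1) N = totalFactor d N * ((N + (d + 1)) ^ 2 / (2 * N + (d + 1))) := by
  have h2 : 0 < Real.Gamma (2 * N + (d + 1)) := Real.Gamma_pos_of_pos (by positivity)
  rw [totalFactor, totalFactor, Nat.cast_succ, ← add_assoc N, ← add_assoc (2 * N),
    Real.Gamma_add_one (by positivity), Real.Gamma_add_one (by positivity)]
  have h3 : 2 * N + ((d : ℝ) + 1) ≠ 0 := by positivity
  field_simp

lemma exists_totalFactor_bound (d : ℕ) : ∃ C, 0 ≤ C ∧ ∀ N : ℝ, 1 ≤ N → ∃ E,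
    totalFactor d N = √Real.pi * (1 / 2) ^ d * N ^ (d + 1 / 2 : ℝ) * E ∧ |E - 1| ≤ C / N := by
  induction d with
  | zero =>
    refine ⟨1, zero_le_one, fun N hN => ⟨(gammaQuotRel N)⁻¹, ?_, ?_⟩⟩
    · have h1 : 0 < Real.Gamma (2 * N + 1) := Real.Gamma_pos_of_pos (by linarith)
      have h2 : 0 < Real.Gamma (N + 1) := Real.Gamma_pos_of_pos (by linarith)
      have hpi : 0 < √Real.pi := Real.sqrt_pos.2 Real.pi_pos
      have hN' : 0 < √N := Real.sqrt_pos.2 (by linarith)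
      rw [totalFactor, gammaQuotRel, gammaQuot, Real.sqrt_mul Real.pi_pos.le]
      simp only [Nat.cast_zero, zero_add, pow_zero, mul_one, ← Real.sqrt_eq_rpow]
      field_simp
    · have h1 := one_sub_le_gammaQuotRel (by linarith : 0 < N)
      have h2 := gammaQuotRel_le_one (by linarith : 0 < N)
      have h3 : 1 / (2 * N) ≤ 1 / 2 := by
        rw [div_le_div_iff₀ (by positivity) (by norm_num)]
        linarith
      have h4 : 1 / 2 ≤ gammaQuotRel N := by linarith
      have h5 : (gammaQuotRel N)⁻¹ - 1 = (1 - gammaQuotRel N) / gammaQuotRel N := by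
        field_simp
      rw [h5, abs_of_nonneg (div_nonneg (by linarith) (by linarith)), div_le_iff₀ (by linarith)]
      calc 1 - gammaQuotRel N ≤ 1 / (2 * N) := by linarith
        _ = 1 / N * (1 / 2) := by field_simp
        _ ≤ 1 / N * gammaQuotRel N := by gcongr
  | succ d ih =>
    obtain ⟨C, hC0, hC⟩ := ih
    set j : ℝ := d + 1 with hj
    have hj0 : 0 < j := by positivity
    refine ⟨C * (1 + j) ^ 2 + (2 * j + j ^ 2), by positivity, fun N hN => ?_⟩
    obtain ⟨E, hE, hE1⟩ := hC N hN
    have hN0 : 0 < N := by linarith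
    set q := (N + j) ^ 2 / (N * (N + j / 2)) with hq
    refine ⟨E * q, ?_, ?_⟩
    · rw [totalFactor_succ d hN0, hE, Nat.cast_succ, show (d : ℝ) + 1 + 1 / 2 = d + 1 / 2 + 1 by ring,
        Real.rpow_add_one hN0.ne', pow_succ (1 / 2 : ℝ), hq, ← hj]
      have : N * 2 + j ≠ 0 := by positivity
      field_simp
    · have q0 : 0 ≤ q := by positivity
      have q1 : q ≤ (1 + j) ^ 2 := by
        rw [hq, div_le_iff₀ (by positivity)]
        have h1 : N + j ≤ N * (1 + j) := by nlinarith
        calc (N + j) ^ 2 ≤ (N * (1 + j)) ^ 2 := by gcongr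
          _ = (1 + j) ^ 2 * (N * N) := by ring
          _ ≤ (1 + j) ^ 2 * (N * (N + j / 2)) := by gcongr; linarith
      have q2 : |q - 1| ≤ (2 * j + j ^ 2) / N := by
        have e : q - 1 = (3 / 2 * j * N + j ^ 2) / (N * (N + j / 2)) := by
          rw [hq, div_sub_one (by positivity)]
          congr 1
          ring
        rw [e, abs_of_nonneg (by positivity), div_le_div_iff₀ (by positivity) hN0]
        calc (3 / 2 * j * N + j ^ 2) * N ≤ (2 * j * N + j ^ 2 * N) * N := by
              gcongr
              · norm_num
              · exact le_mul_of_one_le_right (by positivity) hN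
          _ = (2 * j + j ^ 2) * (N * N) := by ring
          _ ≤ (2 * j + j ^ 2) * (N * (N + j / 2)) := by gcongr; linarith
      refine (abs_mul_sub_one_le E q).trans ?_
      rw [abs_of_nonneg q0, add_div]
      refine add_le_add ?_ q2
      calc |E - 1| * q ≤ C / N * (1 + j) ^ 2 := by gcongr
        _ = _ := by ring

lemma abs_prod_sub_one_le {ι : Type*} (t : Finset ι) (r : ι → ℝ) (hr : ∀ i ∈ t, |r i - 1| ≤ 1) :
    |∏ i ∈ t, r i - 1| ≤ 2 ^ t.card * ∑ i ∈ t, |r i - 1| ∧ |∏ i ∈ t, r i| ≤ 2 ^ t.card := by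
  classical
  have habs : ∀ i ∈ t, |r i| ≤ 2 := fun i hi => by
    have := abs_le.1 (hr i hi)
    rw [abs_le]
    constructor <;> linarith
  induction t using Finset.induction_on with
  | empty => simp
  | insert a t ha ih =>
    obtain ⟨h1, h2⟩ := ih (fun i hi => hr i (Finset.mem_insert_of_mem hi))
      (fun i hi => habs i (Finset.mem_insert_of_mem hi))
    have ha2 := habs a (Finset.mem_insert_self a t)
    rw [Finset.prod_insert ha, Finset.sum_insert ha, Finset.card_insert_of_notMem ha, pow_succ]
    have hp : (1 : ℝ) ≤ 2 ^ t.card := one_le_pow₀ (by norm_num)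
    have hs : 0 ≤ ∑ i ∈ t, |r i - 1| := Finset.sum_nonneg fun i _ => abs_nonneg _
    constructor
    · refine (abs_mul_sub_one_le _ _).trans ?_
      have h3 : |r a - 1| * |∏ i ∈ t, r i| ≤ |r a - 1| * 2 ^ t.card := by gcongr
      have h4 : 0 ≤ |r a - 1| * 2 ^ t.card := by positivity
      have h5 : 0 ≤ 2 ^ t.card * ∑ i ∈ t, |r i - 1| := by positivity
      nlinarith
    · rw [abs_mul, mul_comm]
      gcongr

lemma differentiableAt_gammaQuot {κ : ℝ} (hκ : 0 < κ) : DifferentiableAt ℝ gammaQuot κ := by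
  have h : ∀ x : ℝ, 0 < x → DifferentiableAt ℝ Real.Gamma x := fun x hx =>
    Real.differentiableAt_Gamma fun m => by
      have : (0 : ℝ) ≤ m := Nat.cast_nonneg m
      linarith
  have h2 : 0 < Real.Gamma (κ + 1) := Real.Gamma_pos_of_pos (by linarith)
  have d1 : DifferentiableAt ℝ (fun u => Real.Gamma (2 * u + 1)) κ :=
    (h (2 * κ + 1) (by linarith)).comp κ (f := fun u => 2 * u + 1) (by fun_prop)
  have d2 : DifferentiableAt ℝ (fun u => Real.Gamma (u + 1)) κ :=
    (h (κ + 1) (by linarith)).comp κ (f := fun u => u + 1) (by fun_prop)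
  have d3 : DifferentiableAt ℝ (fun u : ℝ => (2 : ℝ) ^ (2 * u)) κ :=
    (differentiableAt_const _).rpow (by fun_prop) (by norm_num)
  exact d1.div (d3.mul (d2.pow 2)) (by positivity)

lemma exists_gammaQuot_lipschitz {κ : ℝ} (hκ : 0 < κ) : ∃ L δ : ℝ, 0 ≤ L ∧ 0 < δ ∧ ∀ u : ℝ,
    |u - κ| < δ → |gammaQuot u / gammaQuot κ - 1| ≤ L * |u - κ| ∧
      |gammaQuot u / gammaQuot κ - 1| ≤ 1 := by
  have hd : DifferentiableAt ℝ (fun u => gammaQuot u / gammaQuot κ) κ :=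
    (differentiableAt_gammaQuot hκ).div_const _
  obtain ⟨L, hL0, hL⟩ := hd.isBigO_sub.exists_nonneg
  have hL := hL.bound
  have h1 : gammaQuot κ / gammaQuot κ = 1 := div_self (gammaQuot_pos hκ.le).ne'
  have hc := Metric.tendsto_nhds.1 hd.continuousAt 1 one_pos
  obtain ⟨δ, hδ, h⟩ := Metric.eventually_nhds_iff.1 (hL.and hc)
  refine ⟨L, δ, hL0, hδ, fun u hu => ?_⟩
  obtain ⟨a, b⟩ := h (by rwa [Real.dist_eq])
  simp only [h1, Real.norm_eq_abs, Real.dist_eq] at a b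
  exact ⟨a, b.le⟩

/-- The ratio of the squared Dirichlet kernel to the kernel of half the bandwidth. -/
noncomputable def squareFactor {d : ℕ} (b : ℝ) (s : Fin d → ℝ) : ℝ :=
  totalFactor d (1 / b) * (gammaQuot ((1 - l1norm s) / b) * ∏ i, gammaQuot (s i / b))

lemma kernel_sq {d : ℕ} {b : ℝ} (hb : 0 < b) {s : Fin d → ℝ} (hs : s ∈ simplex d)
    {x : Fin d → ℝ} (hx : x ∈ simplex d) :
    kernel b s x ^ 2 = squareFactor b s * kernel (b / 2) s x := by
  obtain ⟨h1, h2, h3⟩ := kernel_params hb hs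
  obtain ⟨h1', h2', h3'⟩ := kernel_params (half_pos hb) hs
  set v := (1 - l1norm s) / b with hv
  set u : Fin d → ℝ := fun i => s i / b with hu
  have hv2 : (1 - l1norm s) / (b / 2) = 2 * v := by rw [hv]; field_simp
  have hu2 : ∀ i, s i / (b / 2) = 2 * u i := fun i => by rw [hu]; field_simp
  have hN2 : 1 / (b / 2) = 2 * (1 / b) := by field_simp
  have hsum : 1 / b = v + ∑ i, u i := by
    rw [hv, hu, l1norm_of_mem hs, ← Finset.sum_div]
    field_simp
    ring
  have hv0 : 0 ≤ v := by linarith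
  have hu0 : ∀ i, 0 ≤ u i := fun i => by have := h1 i; simp only [hu]; linarith
  have g1 : ∀ i, 0 < Real.Gamma (u i + 1) := fun i => Real.Gamma_pos_of_pos (by linarith [hu0 i])
  have g2 : ∀ i, 0 < Real.Gamma (2 * u i + 1) := fun i =>
    Real.Gamma_pos_of_pos (by linarith [hu0 i])
  have g3 : 0 < Real.Gamma (v + 1) := Real.Gamma_pos_of_pos (by linarith)
  have g4 : 0 < Real.Gamma (2 * v + 1) := Real.Gamma_pos_of_pos (by linarith)
  have g5 : 0 < Real.Gamma (2 * (1 / b) + (d + 1)) := Real.Gamma_pos_of_pos (by positivity)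
  have p1 : 0 < ∏ i, Real.Gamma (u i + 1) := Finset.prod_pos fun i _ => g1 i
  have p2 : 0 < ∏ i, Real.Gamma (2 * u i + 1) := Finset.prod_pos fun i _ => g2 i
  unfold kernel dirichletDensity squareFactor totalFactor
  simp only [← hv, hv2, hu2, hN2] at h1' h2' h3' ⊢
  rw [l1norm_pos_params h1, l1norm_pos_params h1', h3, h3']
  have hx1 : 0 ≤ 1 - l1norm x := sub_nonneg.2 hx.2
  have e1 : (1 - l1norm x) ^ (2 * v + 1 - 1) = ((1 - l1norm x) ^ (v + 1 - 1)) ^ 2 := by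
    rw [← Real.rpow_mul_natCast hx1]
    congr 1
    push_cast
    ring
  have e2 : ∏ i, x i ^ (2 * u i + 1 - 1) = (∏ i, x i ^ (u i + 1 - 1)) ^ 2 := by
    rw [← Finset.prod_pow]
    refine Finset.prod_congr rfl fun i _ => ?_
    rw [← Real.rpow_mul_natCast (hx.1 i).1]
    congr 1
    push_cast
    ring
  have e3 : ∏ i, gammaQuot (u i) = (∏ i, Real.Gamma (2 * u i + 1)) /
      ((∏ i, (2 : ℝ) ^ (2 * u i)) * (∏ i, Real.Gamma (u i + 1)) ^ 2) := by
    rw [← Finset.prod_pow, ← Finset.prod_mul_distrib, ← Finset.prod_div_distrib]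
    rfl
  have e4 : (2 : ℝ) ^ (2 * (1 / b)) = 2 ^ (2 * v) * ∏ i, (2 : ℝ) ^ (2 * u i) := by
    rw [← Real.rpow_sum_of_pos (by norm_num), ← Real.rpow_add (by norm_num), ← Finset.mul_sum, hsum]
    congr 1
    ring
  have p3 : 0 < ∏ i, (2 : ℝ) ^ (2 * u i) := Finset.prod_pos fun i _ => by positivity
  have p4 : (0 : ℝ) < 2 ^ (2 * v) := by positivity
  change (_ / (_ * ∏ i, Real.Gamma (u i + 1)) * (_ * ∏ i, x i ^ (u i + 1 - 1))) ^ 2 =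
    _ * (_ * ∏ i, gammaQuot (u i)) * _
  rw [e1, e2, e3, e4, gammaQuot]
  field_simp

lemma pos_of_mem_simplexInt {d : ℕ} {s : Fin d → ℝ} (hs : s ∈ simplexInt d) :
    s ∈ simplex d ∧ (∀ i, 0 < s i) ∧ 0 < 1 - l1norm s :=
  ⟨⟨fun i => ⟨(hs.1 i).1.le, (hs.1 i).2.le⟩, hs.2.le⟩, fun i => (hs.1 i).1, sub_pos.2 hs.2⟩

lemma rpow_neg_half_sq {x : ℝ} (hx : 0 ≤ x) : (x ^ (-(1 / 2) : ℝ)) ^ 2 = x⁻¹ := by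
  rw [← Real.rpow_mul_natCast hx]
  norm_num [Real.rpow_neg_one]

lemma leading_factor {d : ℕ} (J : Finset (Fin d)) {b : ℝ} (hb : 0 < b) {s : Fin d → ℝ}
    (hs : s ∈ simplexInt d) :
    √Real.pi * (1 / 2) ^ d * (1 / b) ^ (d + 1 / 2 : ℝ) *
      ((√(Real.pi * ((1 - l1norm s) / b)))⁻¹ * (2 ^ J.card *
        ∏ i ∈ Jᶜ, (√(Real.pi * (s i / b)))⁻¹)) =
      b ^ (-(((d : ℝ) + J.card) / 2)) * psi J s := by
  obtain ⟨-, hs0, ht⟩ := pos_of_mem_simplexInt hs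
  have hpi := Real.pi_pos
  have hq : ∀ i ∈ Jᶜ, 0 < (√(Real.pi * (s i / b)))⁻¹ := fun i _ => by
    have := hs0 i
    positivity
  have hS : 0 < ∏ i ∈ Jᶜ, s i := Finset.prod_pos fun i _ => hs0 i
  have hP := Finset.prod_pos hq
  obtain ⟨m, hm⟩ : ∃ m, d = m + J.card :=
    ⟨d - J.card, (Nat.sub_add_cancel (card_finset_fin_le J)).symm⟩
  have hcard : Jᶜ.card = m := by
    rw [Finset.card_compl, Fintype.card_fin]
    omega
  have hdm : d - J.card = m := by omega
  have e1 : (∏ i ∈ Jᶜ, (√(Real.pi * (s i / b)))⁻¹) ^ 2 =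
      (b / Real.pi) ^ m * (∏ i ∈ Jᶜ, s i)⁻¹ := by
    rw [← Finset.prod_pow, ← hcard, ← Finset.prod_const, ← Finset.prod_inv_distrib,
      ← Finset.prod_mul_distrib]
    refine Finset.prod_congr rfl fun i _ => ?_
    have := hs0 i
    rw [inv_pow, Real.sq_sqrt (by positivity)]
    field_simp
  have e2 : ((1 / b) ^ (d + 1 / 2 : ℝ)) ^ 2 = (1 / b) ^ (2 * d + 1) := by
    rw [← Real.rpow_mul_natCast (by positivity), ← Real.rpow_natCast]
    congr 1
    push_cast
    ring
  have e3 : (b ^ (-(((d : ℝ) + J.card) / 2))) ^ 2 = (b ^ (d + J.card))⁻¹ := by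
    rw [← Real.rpow_mul_natCast hb.le, ← Real.rpow_natCast, ← Real.rpow_neg hb.le]
    congr 1
    push_cast
    ring
  have hpsi : 0 < psi J s := by
    unfold psi
    positivity
  refine (sq_eq_sq₀ (by positivity) (by positivity)).1 ?_
  simp only [mul_pow, inv_pow, e1, e2, e3]
  rw [psi, rpow_neg_half_sq (by positivity), Real.sq_sqrt hpi.le, Real.sq_sqrt (by positivity), hdm]
  generalize J.card = c at *
  subst hm
  have f1 : (((1 / 2 : ℝ) ^ (m + c))) ^ 2 = (4 ^ m * 4 ^ c)⁻¹ := by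
    rw [← pow_add, ← pow_mul, mul_comm, pow_mul, ← inv_pow]
    norm_num
  have f2 : ((2 : ℝ) ^ c) ^ 2 = 4 ^ c := by
    rw [← pow_mul, mul_comm, pow_mul]
    norm_num
  rw [f1, f2, one_div, inv_pow, div_pow, mul_pow]
  field_simp
  ring

lemma psi_lower {d : ℕ} (J : Finset (Fin d)) {s : Fin d → ℝ} (hs : s ∈ simplexInt d) :
    ((4 * Real.pi) ^ d) ^ (-(1 / 2) : ℝ) ≤ psi J s := by
  obtain ⟨hS, hs0, ht⟩ := pos_of_mem_simplexInt hs
  have hP : 0 < ∏ i ∈ Jᶜ, s i := Finset.prod_pos fun i _ => hs0 i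
  have hP1 : ∏ i ∈ Jᶜ, s i ≤ 1 := Finset.prod_le_one (fun i _ => (hs0 i).le) fun i _ => (hS.1 i).2
  have ht1 : 1 - l1norm s ≤ 1 := by
    have : 0 ≤ l1norm s := Finset.sum_nonneg fun i _ => abs_nonneg _
    linarith
  have h4 : 1 ≤ 4 * Real.pi := by linarith [Real.pi_gt_three]
  unfold psi
  refine Real.rpow_le_rpow_of_nonpos (by positivity) ?_ (by norm_num)
  calc (4 * Real.pi) ^ (d - J.card) * (1 - l1norm s) * ∏ i ∈ Jᶜ, s i
      ≤ (4 * Real.pi) ^ d * 1 * 1 := by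
        gcongr
        exact Nat.sub_le _ _
    _ = _ := by ring

/-- The relative error in the variance expansion. -/
noncomputable def relError {d : ℕ} (J : Finset (Fin d)) (κ : Fin d → ℝ) (b : ℝ) (s : Fin d → ℝ) :
    ℝ :=
  b ^ (1 / 2 : ℝ) * ((1 - l1norm s) ^ (-(1 / 2) : ℝ) + ∑ i ∈ Jᶜ, s i ^ (-(1 / 2) : ℝ)) +
    ∑ i ∈ J, |s i / b - κ i|

lemma abs_gammaQuotRel_div_sub_one_le {t b : ℝ} (hb : 0 < b) (h : 1 ≤ t / b) :
    |gammaQuotRel (t / b) - 1| ≤ b ^ (1 / 2 : ℝ) * t ^ (-(1 / 2) : ℝ) ∧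
      |gammaQuotRel (t / b) - 1| ≤ 1 := by
  have hu : 0 < t / b := by linarith
  have ht : 0 < t := by
    have := mul_pos hu hb
    rwa [div_mul_cancel₀ _ hb.ne'] at this
  have h1 := abs_gammaQuotRel_sub_one_le hu
  have h2 : 1 / (2 * (t / b)) ≤ b / t := by
    rw [div_le_div_iff₀ (by positivity) ht]
    have : b * (2 * (t / b)) = 2 * t := by field_simp
    linarith
  have hbt : b / t ≤ 1 := (div_le_one ht).2 ((one_le_div hb).1 h)
  refine ⟨h1.trans (h2.trans ?_), h1.trans (h2.trans hbt)⟩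
  rw [Real.rpow_neg ht.le, ← div_eq_mul_inv, ← Real.div_rpow hb.le ht.le]
  exact Real.self_le_rpow_of_le_one (by positivity) hbt (by norm_num)

lemma sqrt_le_relError {d : ℕ} (J : Finset (Fin d)) (κ : Fin d → ℝ) {b : ℝ} (hb : 0 < b)
    {s : Fin d → ℝ} (hs : s ∈ simplexInt d) : b ^ (1 / 2 : ℝ) ≤ relError J κ b s := by
  obtain ⟨hS, hs0, ht⟩ := pos_of_mem_simplexInt hs
  have ht1 : 1 - l1norm s ≤ 1 := by
    have : 0 ≤ l1norm s := Finset.sum_nonneg fun i _ => abs_nonneg _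
    linarith
  have h1 : 1 ≤ (1 - l1norm s) ^ (-(1 / 2) : ℝ) :=
    Real.one_le_rpow_of_pos_of_le_one_of_nonpos ht ht1 (by norm_num)
  have h2 : 0 ≤ ∑ i ∈ Jᶜ, s i ^ (-(1 / 2) : ℝ) :=
    Finset.sum_nonneg fun i _ => Real.rpow_nonneg (hs0 i).le _
  have h3 : 0 ≤ ∑ i ∈ J, |s i / b - κ i| := Finset.sum_nonneg fun i _ => abs_nonneg _
  have h4 : 0 ≤ b ^ (1 / 2 : ℝ) := by positivity
  unfold relError
  nlinarith

lemma exists_squareFactor_bound {d : ℕ} (J : Finset (Fin d)) {κ : Fin d → ℝ} (hκ : ∀ i, 0 < κ i) :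
    ∃ C δ : ℝ, 0 ≤ C ∧ 0 < δ ∧ ∀ b : ℝ, 0 < b → b ≤ 1 → ∀ s ∈ simplexInt d,
      (∀ i ∈ J, |s i / b - κ i| < δ) → (∀ i ∉ J, 1 ≤ s i / b) → 1 ≤ (1 - l1norm s) / b →
      ∃ R, squareFactor b s = b ^ (-(((d : ℝ) + J.card) / 2)) *
          (psi J s * ∏ i ∈ J, gammaRatio (κ i)) * R ∧
        |R - 1| ≤ C * relError J κ b s ∧ |R| ≤ C := by
  obtain ⟨C₀, hC₀, hE⟩ := exists_totalFactor_bound d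
  choose L δ hL hδ hLδ using fun i => exists_gammaQuot_lipschitz (hκ i)
  set L' := ∑ i, L i + 1 with hL'
  have hLsum : 0 ≤ ∑ i, L i := Finset.sum_nonneg fun i _ => hL i
  have hLL : ∀ i, L i ≤ L' := fun i => by
    have := Finset.single_le_sum (fun j _ => hL j) (Finset.mem_univ i)
    linarith
  obtain ⟨δ', hδ'0, hδ'⟩ : ∃ δ' > 0, ∀ i, δ' ≤ δ i := by
    rcases isEmpty_or_nonempty (Fin d) with h | h
    · exact ⟨1, one_pos, fun i => h.elim i⟩
    · obtain ⟨i, hi⟩ := Finite.exists_min δ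
      exact ⟨δ i, hδ i, hi⟩
  set T : ℝ := 2 ^ d * L' with hT
  have hT0 : 0 ≤ T := by positivity
  refine ⟨C₀ * 2 ^ (d + 1) + 2 ^ d + T + (C₀ + 1) * 2 ^ (d + 1), δ', by positivity, hδ'0,
    fun b hb hb1 s hs hJ hJc ht1 => ?_⟩
  obtain ⟨hS, hs0, ht⟩ := pos_of_mem_simplexInt hs
  obtain ⟨E, hE1, hE2⟩ := hE (1 / b) ((one_le_div hb).2 hb1)
  rw [div_div_eq_mul_div, div_one] at hE2
  set v := (1 - l1norm s) / b with hv
  set r : Fin d → ℝ := fun i => if i ∈ J then gammaQuot (s i / b) / gammaQuot (κ i)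
    else gammaQuotRel (s i / b) with hr
  obtain ⟨hw1, hw2⟩ := abs_gammaQuotRel_div_sub_one_le hb ht1
  have hr1 : ∀ i ∈ Finset.univ, |r i - 1| ≤ 1 := fun i _ => by
    by_cases hi : i ∈ J
    · simp only [hr, if_pos hi]
      exact (hLδ i _ ((hJ i hi).trans_le (hδ' i))).2
    · simp only [hr, if_neg hi]
      exact (abs_gammaQuotRel_div_sub_one_le hb (hJc i hi)).2
  obtain ⟨hp1, hp2⟩ := abs_prod_sub_one_le Finset.univ r hr1
  rw [Finset.card_univ, Fintype.card_fin] at hp1 hp2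
  have hrsum : ∑ i, |r i - 1| ≤ L' * (b ^ (1 / 2 : ℝ) * ∑ i ∈ Jᶜ, s i ^ (-(1 / 2) : ℝ) +
      ∑ i ∈ J, |s i / b - κ i|) := by
    rw [← Finset.sum_add_sum_compl J, add_comm, mul_add]
    refine add_le_add ?_ ?_
    · rw [Finset.mul_sum, Finset.mul_sum]
      refine Finset.sum_le_sum fun i hi => ?_
      have hi' : i ∉ J := Finset.mem_compl.1 hi
      simp only [hr, if_neg hi']
      refine (abs_gammaQuotRel_div_sub_one_le hb (hJc i hi')).1.trans
        (le_mul_of_one_le_left ?_ (by linarith))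
      have := hs0 i
      positivity
    · rw [Finset.mul_sum]
      refine Finset.sum_le_sum fun i hi => ?_
      simp only [hr, if_pos hi]
      exact (hLδ i _ ((hJ i hi).trans_le (hδ' i))).1.trans
        (mul_le_mul_of_nonneg_right (hLL i) (abs_nonneg _))
  have hsq : b ^ (1 / 2 : ℝ) ≤ relError J κ b s := sqrt_le_relError J κ hb hs
  have hb2 : b ≤ b ^ (1 / 2 : ℝ) := Real.self_le_rpow_of_le_one hb.le hb1 (by norm_num)
  have hsum0 : 0 ≤ ∑ i ∈ Jᶜ, s i ^ (-(1 / 2) : ℝ) :=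
    Finset.sum_nonneg fun i _ => Real.rpow_nonneg (hs0 i).le _
  have hJ0 : 0 ≤ ∑ i ∈ J, |s i / b - κ i| := Finset.sum_nonneg fun i _ => abs_nonneg _
  have hb0 : 0 ≤ b ^ (1 / 2 : ℝ) := by positivity
  have ht0 : 0 ≤ (1 - l1norm s) ^ (-(1 / 2) : ℝ) := Real.rpow_nonneg ht.le _
  have hrel1 : b ^ (1 / 2 : ℝ) * (1 - l1norm s) ^ (-(1 / 2) : ℝ) ≤ relError J κ b s := by
    unfold relError
    nlinarith [mul_nonneg hb0 hsum0]
  have hrel2 : b ^ (1 / 2 : ℝ) * ∑ i ∈ Jᶜ, s i ^ (-(1 / 2) : ℝ) +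
      ∑ i ∈ J, |s i / b - κ i| ≤ relError J κ b s := by
    unfold relError
    nlinarith [mul_nonneg hb0 ht0]
  have hrel0 : 0 ≤ relError J κ b s := hb0.trans hsq
  have hwabs : |gammaQuotRel v| ≤ 2 := by
    have := abs_le.1 hw2
    rw [abs_le]
    constructor <;> linarith
  have hY : |gammaQuotRel v * ∏ i, r i| ≤ 2 ^ (d + 1) := by
    rw [abs_mul, pow_succ, mul_comm]
    gcongr
  have hY1 : |gammaQuotRel v * ∏ i, r i - 1| ≤ (2 ^ d + T) * relError J κ b s := by
    refine (abs_mul_sub_one_le _ _).trans ?_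
    rw [add_mul]
    refine add_le_add ?_ ?_
    · rw [mul_comm]
      gcongr
      exact hw1.trans hrel1
    · refine hp1.trans ?_
      rw [hT, mul_assoc]
      gcongr
      exact hrsum.trans (by gcongr)
  have hEabs : |E| ≤ C₀ + 1 := by
    have h1 : C₀ * b ≤ C₀ := mul_le_of_le_one_right hC₀ hb1
    have := abs_le.1 (hE2.trans h1)
    rw [abs_le]
    constructor <;> linarith
  refine ⟨E * (gammaQuotRel v * ∏ i, r i), ?_, ?_, ?_⟩
  · have hlead := leading_factor J hb hs
    have hgq : ∀ t : ℝ, 0 < t → gammaQuot t = (√(Real.pi * t))⁻¹ * gammaQuotRel t := fun t ht => by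
      have := Real.pi_pos
      rw [gammaQuotRel, inv_mul_cancel_left₀ (by positivity)]
    have hprod : ∏ i, gammaQuot (s i / b) = (2 ^ J.card * ∏ i ∈ Jᶜ, (√(Real.pi * (s i / b)))⁻¹) *
        (∏ i ∈ J, gammaRatio (κ i)) * ∏ i, r i := by
      rw [← Finset.prod_mul_prod_compl J, ← Finset.prod_mul_prod_compl J r]
      have h1 : ∏ i ∈ J, gammaQuot (s i / b) =
          (2 ^ J.card * ∏ i ∈ J, gammaRatio (κ i)) * ∏ i ∈ J, r i := by
        rw [← Finset.prod_const, ← Finset.prod_mul_distrib, ← Finset.prod_mul_distrib]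
        refine Finset.prod_congr rfl fun i hi => ?_
        simp only [hr, if_pos hi]
        rw [← gammaQuot_eq_two_mul_gammaRatio, mul_div_cancel₀]
        exact (gammaQuot_pos (hκ i).le).ne'
      have h2 : ∏ i ∈ Jᶜ, gammaQuot (s i / b) =
          (∏ i ∈ Jᶜ, (√(Real.pi * (s i / b)))⁻¹) * ∏ i ∈ Jᶜ, r i := by
        rw [← Finset.prod_mul_distrib]
        refine Finset.prod_congr rfl fun i hi => ?_
        simp only [hr, if_neg (Finset.mem_compl.1 hi)]
        exact hgq _ (div_pos (hs0 i) hb)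
      rw [h1, h2]
      ring
    rw [squareFactor, hE1, ← hv, hgq v (by linarith), hprod, ← mul_assoc (b ^ _), ← hlead]
    ring
  · refine (abs_mul_sub_one_le _ _).trans ?_
    have h1 : |E - 1| * |gammaQuotRel v * ∏ i, r i| ≤ C₀ * relError J κ b s * 2 ^ (d + 1) := by
      gcongr
      exact hE2.trans (by gcongr; exact hb2.trans hsq)
    have h2 : 0 ≤ (C₀ + 1) * 2 ^ (d + 1) * relError J κ b s := by positivity
    linarith
  · rw [abs_mul]
    have h1 : |E| * |gammaQuotRel v * ∏ i, r i| ≤ (C₀ + 1) * 2 ^ (d + 1) := by gcongr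
    have h2 : 0 ≤ C₀ * 2 ^ (d + 1) + 2 ^ d + T := by positivity
    linarith

lemma exists_smoothed_lipschitz {d : ℕ} {f : (Fin d → ℝ) → ℝ} {L : NNReal}
    (hf : LipschitzOnWith L f (simplex d)) : ∃ C, 0 ≤ C ∧ ∀ b : ℝ, 0 < b → b ≤ 1 →
      ∀ s ∈ simplex d, |smoothed f b s - f s| ≤ C * b ^ (1 / 2 : ℝ) := by
  obtain ⟨C, hC0, hC⟩ := exists_square_bound d
  refine ⟨L * (1 + d * C), by positivity, fun b hb hb1 s hs => ?_⟩
  have e : smoothed f b s - f s = ∫ x in simplex d, (f x + -f s) * kernel b s x := by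
    rw [integral_add_mul_kernel hb hs hf.continuousOn (by fun_prop),
      integral_const_mul_kernel hb hs, smoothed]
    ring
  set q := b ^ (1 / 2 : ℝ) with hq
  have hq0 : 0 < q := by positivity
  have hqq : q * q = b := by
    rw [hq, ← Real.rpow_add hb]
    norm_num
  rw [e]
  refine (abs_integral_mul_kernel_le hb hs (h₁ := fun x => f x + -f s) (h₂ := fun x => L * q +
    L / q * ∑ i, (x i - s i) ^ 2) (hf.continuousOn.add (by fun_prop)) (by fun_prop)
    fun x hx => ?_).trans ?_
  · have h1 := hf.dist_le_mul x hx s hs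
    rw [Real.dist_eq, dist_eq_norm] at h1
    have h2 := norm_pow_le_sum (x - s) (k := 2) (by decide) (by norm_num)
    have h3 : ‖x - s‖ ≤ q + 1 / q * ‖x - s‖ ^ 2 := by
      have : q + 1 / q * ‖x - s‖ ^ 2 - ‖x - s‖ =
          ((q - ‖x - s‖) ^ 2 + q * ‖x - s‖) / q := by field_simp; ring
      have h4 : 0 ≤ ((q - ‖x - s‖) ^ 2 + q * ‖x - s‖) / q := by positivity
      linarith
    rw [← sub_eq_add_neg]
    calc |f x - f s| ≤ L * ‖x - s‖ := h1
      _ ≤ L * (q + 1 / q * ‖x - s‖ ^ 2) := by gcongr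
      _ ≤ L * (q + 1 / q * ∑ i, (x - s) i ^ 2) := by gcongr
      _ = _ := by simp only [Pi.sub_apply]; ring
  · rw [integral_add_mul_kernel hb hs (by fun_prop) (by fun_prop), integral_const_mul_kernel hb hs,
      integral_const_mul_mul_kernel, integral_sum_mul_kernel hb hs _ (fun i => by fun_prop)]
    calc L * q + L / q * ∑ i, ∫ x in simplex d, (x i - s i) ^ 2 * kernel b s x
        ≤ L * q + L / q * (d * (C * b)) := by
          gcongr
          exact (Finset.sum_le_sum fun i _ => hC b hb hb1 s hs i).trans (by simp)
      _ = L * (1 + d * C) * q := by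
          rw [← hqq]
          field_simp

section Estimator

variable {Ω : Type*} [MeasurableSpace Ω] {μ : Measure Ω} {d : ℕ} {f : (Fin d → ℝ) → ℝ}
  {X : ℕ → Ω → Fin d → ℝ}

lemma integral_comp_simplexLaw (hf : ∀ x ∈ simplex d, 0 ≤ f x) (hfc : ContinuousOn f (simplex d))
    {Y : Ω → Fin d → ℝ} (hY : HasLaw Y (simplexLaw f) μ) {h : (Fin d → ℝ) → ℝ}
    (hh : Continuous h) : ∫ ω, h (Y ω) ∂μ = ∫ x in simplex d, f x * h x := by
  have hm : AEMeasurable f ((volume : Measure (Fin d → ℝ)).restrict (simplex d)) :=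
    hfc.aemeasurable (measurableSet_simplex d)
  refine (hY.integral_comp hh.aestronglyMeasurable).trans ?_
  rw [simplexLaw, integral_withDensity_eq_integral_toReal_smul₀ hm.ennreal_ofReal
    (ae_of_all _ fun x => ENNReal.ofReal_lt_top)]
  refine setIntegral_congr_fun (measurableSet_simplex d) fun x hx => ?_
  simp only [ENNReal.toReal_ofReal (hf x hx), smul_eq_mul]

variable [IsProbabilityMeasure μ]

lemma memLp_kernel_comp {Y : Ω → Fin d → ℝ} (hY : HasLaw Y (simplexLaw f) μ) {b : ℝ} (hb : 0 < b)
    {s : Fin d → ℝ} (hs : s ∈ simplex d) : MemLp (fun ω => kernel b s (Y ω)) 2 μ := by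
  have hc := continuous_kernel hb hs
  obtain ⟨C, hC⟩ := (isCompact_simplex d).exists_bound_of_continuousOn hc.continuousOn
  have hS : ∀ᵐ x ∂(simplexLaw f), x ∈ simplex d :=
    (withDensity_absolutelyContinuous _ _).ae_le (ae_restrict_mem (measurableSet_simplex d))
  have hS' : ∀ᵐ ω ∂μ, Y ω ∈ simplex d := by
    rw [← hY.map_eq] at hS
    exact ae_of_ae_map hY.aemeasurable hS
  exact MemLp.of_bound (hc.measurable.comp_aemeasurable hY.aemeasurable).aestronglyMeasurable C
    (hS'.mono fun ω hω => hC _ hω)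

lemma memLp_estimator (hlaw : ∀ k, HasLaw (X k) (simplexLaw f) μ) (n : ℕ) {b : ℝ} (hb : 0 < b)
    {s : Fin d → ℝ} (hs : s ∈ simplex d) : MemLp (estimator X n b s) 2 μ :=
  (memLp_finsetSum _ fun k _ => memLp_kernel_comp (hlaw k) hb hs).const_mul _

lemma integral_estimator (hf : ∀ x ∈ simplex d, 0 ≤ f x) (hfc : ContinuousOn f (simplex d))
    (hlaw : ∀ k, HasLaw (X k) (simplexLaw f) μ) {n : ℕ} (hn : 1 ≤ n) {b : ℝ} (hb : 0 < b)
    {s : Fin d → ℝ} (hs : s ∈ simplex d) : ∫ ω, estimator X n b s ω ∂μ = smoothed f b s := by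
  have hn' : (n : ℝ) ≠ 0 := Nat.cast_ne_zero.2 (by omega)
  unfold estimator
  rw [integral_const_mul, integral_finsetSum _ fun k _ =>
    (memLp_kernel_comp (hlaw k) hb hs).integrable one_le_two]
  simp only [integral_comp_simplexLaw hf hfc (hlaw _) (continuous_kernel hb hs)]
  rw [Finset.sum_const, Finset.card_range, nsmul_eq_mul, inv_mul_cancel_left₀ hn', smoothed]

lemma variance_estimator (hf : ∀ x ∈ simplex d, 0 ≤ f x) (hfc : ContinuousOn f (simplex d))
    (hlaw : ∀ k, HasLaw (X k) (simplexLaw f) μ) (hindep : iIndepFun X μ) {n : ℕ} (hn : 1 ≤ n)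
    {b : ℝ} (hb : 0 < b) {s : Fin d → ℝ} (hs : s ∈ simplex d) :
    variance (estimator X n b s) μ =
      (n : ℝ)⁻¹ * (squareFactor b s * smoothed f (b / 2) s - smoothed f b s ^ 2) := by
  have hn' : (n : ℝ) ≠ 0 := Nat.cast_ne_zero.2 (by omega)
  have hc := continuous_kernel hb hs
  have hsum : variance (∑ k ∈ Finset.range n, fun ω => kernel b s (X k ω)) μ =
      ∑ k ∈ Finset.range n, variance (fun ω => kernel b s (X k ω)) μ :=
    IndepFun.variance_sum (fun k _ => memLp_kernel_comp (hlaw k) hb hs)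
      fun i _ j _ hij => (hindep.comp (fun _ => kernel b s) fun _ => hc.measurable).indepFun hij
  have hvar : ∀ k, variance (fun ω => kernel b s (X k ω)) μ =
      squareFactor b s * smoothed f (b / 2) s - smoothed f b s ^ 2 := fun k => by
    rw [variance_eq_sub (memLp_kernel_comp (hlaw k) hb hs),
      integral_comp_simplexLaw hf hfc (hlaw k) hc]
    congr 1
    refine (integral_comp_simplexLaw hf hfc (hlaw k) (hc.pow 2)).trans ?_
    rw [smoothed, ← integral_const_mul]
    refine setIntegral_congr_fun (measurableSet_simplex d) fun x hx => ?_
    simp only [Pi.pow_apply]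
    linear_combination f x * kernel_sq hb hs hx
  have he : estimator X n b s =
      fun ω => (n : ℝ)⁻¹ * (∑ k ∈ Finset.range n, fun ω => kernel b s (X k ω)) ω := by
    ext ω
    rw [estimator, Finset.sum_apply]
  rw [he, variance_const_mul, hsum]
  simp only [hvar]
  rw [Finset.sum_const, Finset.card_range, nsmul_eq_mul]
  field_simp

end Estimator

lemma abs_variance_core_le {A M R G E F f₀ C C' K c : ℝ} (hA : A = M * R) (hM : M = G * c)
    (hG : 0 ≤ G) (hc : 0 ≤ c) (hR : |R - 1| ≤ C * E) (hR' : |R| ≤ C) (hC : 0 ≤ C)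
    (hF : |F - f₀| ≤ C' * E) (hf : |f₀| ≤ K) (hE : 0 ≤ E) {F₁ D : ℝ}
    (hF₁ : F₁ ^ 2 ≤ D * (G * E)) :
    |A * F - F₁ ^ 2 - M * f₀| ≤ (c * (C * C' + C * K) + D) * (G * E) := by
  have hK : 0 ≤ K := (abs_nonneg _).trans hf
  have hM0 : 0 ≤ M := hM ▸ mul_nonneg hG hc
  have e : A * F - F₁ ^ 2 - M * f₀ = (M * (R * (F - f₀)) + M * ((R - 1) * f₀)) - F₁ ^ 2 := by
    rw [hA]
    ring
  rw [e]
  refine (abs_sub _ _).trans ?_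
  refine (add_le_add (abs_add_le _ _) le_rfl).trans ?_
  rw [abs_mul, abs_mul, abs_mul, abs_mul, abs_of_nonneg hM0, abs_of_nonneg (sq_nonneg F₁)]
  calc M * (|R| * |F - f₀|) + M * (|R - 1| * |f₀|) + F₁ ^ 2
      ≤ M * (C * (C' * E)) + M * (C * E * K) + D * (G * E) := by gcongr
    _ = _ := by rw [hM]; ring

lemma psi_pos {d : ℕ} (J : Finset (Fin d)) {s : Fin d → ℝ} (hs : s ∈ simplexInt d) :
    0 < psi J s :=
  (Real.rpow_pos_of_pos (pow_pos (by have := Real.pi_pos; linarith) _) _).trans_le (psi_lower J hs)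

lemma exists_variance_bound {Ω : Type*} [MeasurableSpace Ω] {μ : Measure Ω}
    [IsProbabilityMeasure μ] {d : ℕ} (hd : 1 ≤ d) {f : (Fin d → ℝ) → ℝ} {X : ℕ → Ω → Fin d → ℝ}
    (hf : ∀ x ∈ simplex d, 0 ≤ f x) {L : NNReal} (hL : LipschitzOnWith L f (simplex d))
    (hlaw : ∀ k, HasLaw (X k) (simplexLaw f) μ) (hindep : iIndepFun X μ)
    (J : Finset (Fin d)) {κ : Fin d → ℝ} (hκ : ∀ i, 0 < κ i) :
    ∃ C δ : ℝ, 0 < δ ∧ ∀ (n : ℕ) (b : ℝ), 1 ≤ n → 0 < b → b ≤ 1 → ∀ s ∈ simplexInt d,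
      (∀ i ∈ J, |s i / b - κ i| < δ) → (∀ i ∉ J, 1 ≤ s i / b) → 1 ≤ (1 - l1norm s) / b →
      |variance (estimator X n b s) μ -
          (n : ℝ)⁻¹ * b ^ (-(((d : ℝ) + J.card) / 2)) *
            (psi J s * f s * ∏ i ∈ J, gammaRatio (κ i))| ≤
        (n : ℝ)⁻¹ * b ^ (-(((d : ℝ) + J.card) / 2)) * (C * psi J s * relError J κ b s) := by
  obtain ⟨C, δ, hC0, hδ, hC⟩ := exists_squareFactor_bound J hκ
  obtain ⟨C', hC'0, hC'⟩ := exists_smoothed_lipschitz hL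
  obtain ⟨K, hK⟩ := (isCompact_simplex d).exists_bound_of_continuousOn hL.continuousOn
  have h4 : 0 < 4 * Real.pi := by linarith [Real.pi_pos]
  set p : ℝ := ((4 * Real.pi) ^ d) ^ (-(1 / 2) : ℝ) with hp
  have hp0 : 0 < p := by positivity
  set c := ∏ i ∈ J, gammaRatio (κ i) with hc
  have hc0 : 0 ≤ c := Finset.prod_nonneg fun i _ => by
    have := gammaQuot_pos (hκ i).le
    rw [gammaQuot_eq_two_mul_gammaRatio] at this
    linarith
  refine ⟨c * (C * C' + C * K) + (K + C') ^ 2 / p, δ, hδ,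
    fun n b hn hb hb1 s hs hJ hJc ht => ?_⟩
  have hS := (pos_of_mem_simplexInt hs).1
  obtain ⟨R, hA, hR1, hR⟩ := hC b hb hb1 s hs hJ hJc ht
  rw [variance_estimator hf hL.continuousOn hlaw hindep hn hb hS]
  set B := b ^ (-(((d : ℝ) + J.card) / 2)) with hB
  have hB0 : 0 < B := by positivity
  set E := relError J κ b s with hE
  have hbE : b ^ (1 / 2 : ℝ) ≤ E := sqrt_le_relError J κ hb hs
  have hq0 : 0 < b ^ (1 / 2 : ℝ) := by positivity
  have hK0 : 0 ≤ K := (norm_nonneg _).trans (hK s hS)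
  have hF : |smoothed f (b / 2) s - f s| ≤ C' * E := by
    refine (hC' (b / 2) (half_pos hb) (by linarith) s hS).trans ?_
    gcongr
    refine le_trans ?_ hbE
    gcongr
    linarith
  have hF₁ : smoothed f b s ^ 2 ≤ (K + C') ^ 2 / p * (B * psi J s * E) := by
    have h1 : |smoothed f b s| ≤ K + C' := by
      have h2 := hC' b hb hb1 s hS
      have h3 := hK s hS
      have h4 : b ^ (1 / 2 : ℝ) ≤ 1 := Real.rpow_le_one hb.le hb1 (by norm_num)
      have h5 := abs_add_le (smoothed f b s - f s) (f s)
      rw [sub_add_cancel] at h5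
      rw [Real.norm_eq_abs] at h3
      nlinarith
    have h2 : 1 ≤ B * b ^ (1 / 2 : ℝ) := by
      rw [hB, ← Real.rpow_add hb]
      refine Real.one_le_rpow_of_pos_of_le_one_of_nonpos hb hb1 ?_
      have h6 : (1 : ℝ) ≤ d := by exact_mod_cast hd
      have h7 : (0 : ℝ) ≤ J.card := Nat.cast_nonneg _
      linarith
    have h3 : p ≤ B * psi J s * E := by
      calc p = 1 * p := (one_mul p).symm
        _ ≤ (B * b ^ (1 / 2 : ℝ)) * psi J s := by
          gcongr
          exact psi_lower J hs
        _ ≤ (B * E) * psi J s := by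
          have := psi_pos J hs
          gcongr
        _ = _ := by ring
    calc smoothed f b s ^ 2 = |smoothed f b s| ^ 2 := (sq_abs _).symm
      _ ≤ (K + C') ^ 2 := by gcongr
      _ = (K + C') ^ 2 / p * p := by field_simp
      _ ≤ _ := by gcongr
  have hcore := abs_variance_core_le (M := B * (psi J s * c)) (G := B * psi J s) (c := c)
    hA (by ring) (mul_nonneg hB0.le (psi_pos J hs).le) hc0 hR1 hR hC0 hF
    (hK s hS) (hq0.le.trans hbE) hF₁
  have hn0 : (0 : ℝ) ≤ (n : ℝ)⁻¹ := by positivity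
  calc _ = (n : ℝ)⁻¹ * |squareFactor b s * smoothed f (b / 2) s - smoothed f b s ^ 2 -
        B * (psi J s * c) * f s| := by
        rw [← abs_of_nonneg hn0, ← abs_mul, abs_of_nonneg hn0]
        congr 1
        ring
    _ ≤ (n : ℝ)⁻¹ * ((c * (C * C' + C * K) + (K + C') ^ 2 / p) * (B * psi J s * E)) := by gcongr
    _ = _ := by ring

end DirichletKernel

theorem mainTheorem2 {Ω : Type*} [MeasurableSpace Ω] (μ : Measure Ω) [IsProbabilityMeasure μ]
    (d : ℕ) (hd : 1 ≤ d) (f : (Fin d → ℝ) → ℝ)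
    (hf : ∀ x ∈ DirichletKernel.simplex d, 0 ≤ f x)
    (X : ℕ → Ω → Fin d → ℝ)
    (hlaw : ∀ k, HasLaw (X k) (DirichletKernel.simplexLaw f) μ)
    (hindep : iIndepFun X μ) :
    -- the estimator has a mean and a variance
    (∀ (n : ℕ) (b : ℝ), 0 < b → ∀ s ∈ DirichletKernel.simplex d,
      MemLp (DirichletKernel.estimator X n b s) 2 μ) ∧
    -- bias, uniformly on the simplex, for twice continuously differentiable densities
    (ContDiffOn ℝ 2 f (DirichletKernel.simplex d) →
      (∀ (n : ℕ) (b : ℝ), 1 ≤ n → 0 < b → ∀ s ∈ DirichletKernel.simplex d,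
        DirichletKernel.bias μ f X n b s = DirichletKernel.smoothed f b s - f s) ∧
      ∀ ε : ℝ, 0 < ε → ∃ b₀ : ℝ, 0 < b₀ ∧
        ∀ (n : ℕ) (b : ℝ), 1 ≤ n → 0 < b → b < b₀ → ∀ s ∈ DirichletKernel.simplex d,
          |DirichletKernel.bias μ f X n b s - b * DirichletKernel.biasTerm f s| ≤ ε * b) ∧
    -- variance, for Lipschitz densities
    ((∃ L : NNReal, LipschitzOnWith L f (DirichletKernel.simplex d)) →
      -- at a given interior point
      (∀ s ∈ DirichletKernel.simplexInt d, ∃ C b₀ : ℝ, 0 < b₀ ∧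
        ∀ (n : ℕ) (b : ℝ), 1 ≤ n → 0 < b → b < b₀ →
          |variance (DirichletKernel.estimator X n b s) μ -
              (n : ℝ)⁻¹ * b ^ (-((d : ℝ) / 2)) * (DirichletKernel.psi ∅ s * f s)| ≤
            (n : ℝ)⁻¹ * b ^ (-((d : ℝ) / 2)) * (C * b ^ (1 / 2 : ℝ))) ∧
      -- at points which may move with `n`: near a face (`J` nonempty), or away from
      -- the boundary at the scale of the bandwidth (`J` empty)
      ∀ (J : Finset (Fin d)) (κ : Fin d → ℝ), (∀ i, 0 < κ i) → ∃ C : ℝ,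
        ∀ (b : ℕ → ℝ) (s : ℕ → Fin d → ℝ),
          (∀ n, 0 < b n) → Tendsto b atTop (𝓝 0) →
          (∀ n, s n ∈ DirichletKernel.simplexInt d) →
          (∀ i ∈ J, Tendsto (fun n => s n i / b n) atTop (𝓝 (κ i))) →
          (∀ i ∉ J, Tendsto (fun n => s n i / b n) atTop atTop) →
          Tendsto (fun n => (1 - DirichletKernel.l1norm (s n)) / b n) atTop atTop →
          ∀ᶠ n : ℕ in atTop,
            |variance (DirichletKernel.estimator X n (b n) (s n)) μ -
                (n : ℝ)⁻¹ * b n ^ (-(((d : ℝ) + J.card) / 2)) *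
                  (DirichletKernel.psi J (s n) * f (s n) *
                    ∏ i ∈ J, DirichletKernel.gammaRatio (κ i))| ≤
              (n : ℝ)⁻¹ * b n ^ (-(((d : ℝ) + J.card) / 2)) *
                (C * DirichletKernel.psi J (s n) *
                  (b n ^ (1 / 2 : ℝ) *
                      ((1 - DirichletKernel.l1norm (s n)) ^ (-(1 / 2) : ℝ) +
                        ∑ i ∈ Jᶜ, s n i ^ (-(1 / 2) : ℝ)) +
                    ∑ i ∈ J, |s n i / b n - κ i|))) := by
  refine ⟨fun n b hb s hs => DirichletKernel.memLp_estimator hlaw n hb hs, fun hf2 => ?_, ?_⟩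
  · have hbias : ∀ (n : ℕ) (b : ℝ), 1 ≤ n → 0 < b → ∀ s ∈ DirichletKernel.simplex d,
        DirichletKernel.bias μ f X n b s = DirichletKernel.smoothed f b s - f s :=
      fun n b hn hb s hs => by
        rw [DirichletKernel.bias,
          DirichletKernel.integral_estimator hf hf2.continuousOn hlaw hn hb hs]
    refine ⟨hbias, fun ε hε => ?_⟩
    obtain ⟨b₀, hb₀, h⟩ := DirichletKernel.exists_smoothed_bias hf2 hε
    refine ⟨b₀, hb₀, fun n b hn hb hbb s hs => ?_⟩
    rw [hbias n b hn hb s hs]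
    exact h b hb hbb s hs
  · rintro ⟨L, hL⟩
    constructor
    · intro s hs
      obtain ⟨C, δ, hδ, h⟩ := DirichletKernel.exists_variance_bound hd hf hL hlaw hindep ∅
        (κ := fun _ => 1) fun _ => one_pos
      obtain ⟨-, hs0, ht⟩ := DirichletKernel.pos_of_mem_simplexInt hs
      have hev : ∀ᶠ b : ℝ in 𝓝[>] 0, b ≤ 1 ∧ (∀ i, b ≤ s i) ∧ b ≤ 1 - DirichletKernel.l1norm s :=
        nhdsWithin_le_nhds ((eventually_le_nhds one_pos).and
          ((eventually_all.2 fun i => eventually_le_nhds (hs0 i)).and (eventually_le_nhds ht)))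
      obtain ⟨b₀, hb₀, hb₀'⟩ := mem_nhdsGT_iff_exists_Ioo_subset.1 hev
      refine ⟨C * DirichletKernel.psi ∅ s * ((1 - DirichletKernel.l1norm s) ^ (-(1 / 2) : ℝ) +
        ∑ i, s i ^ (-(1 / 2) : ℝ)), b₀, hb₀, fun n b hn hb hbb => ?_⟩
      obtain ⟨h1, h2, h3⟩ := hb₀' ⟨hb, hbb⟩
      have := h n b hn hb h1 s hs (by simp) (fun i _ => (one_le_div hb).2 (h2 i))
        ((one_le_div hb).2 h3)
      simp only [DirichletKernel.relError, Finset.card_empty, Nat.cast_zero, add_zero,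
        Finset.prod_empty, mul_one, Finset.sum_empty, Finset.compl_empty] at this
      refine this.trans (le_of_eq ?_)
      ring
    · intro J κ hκ
      obtain ⟨C, δ, hδ, h⟩ := DirichletKernel.exists_variance_bound hd hf hL hlaw hindep J hκ
      refine ⟨C, fun b s hb0 hb hs hJ hJc ht => ?_⟩
      have e1 : ∀ᶠ n in atTop, ∀ i ∈ J, |s n i / b n - κ i| < δ :=
        (eventually_all_finset J).2 fun i hi => by
          simpa only [Real.dist_eq] using Metric.tendsto_nhds.1 (hJ i hi) δ hδ
      have e2 : ∀ᶠ n in atTop, ∀ i, i ∉ J → 1 ≤ s n i / b n :=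
        eventually_all.2 fun i => by
          by_cases hi : i ∈ J
          · exact Eventually.of_forall fun n h => absurd hi h
          · exact ((hJc i hi).eventually_ge_atTop 1).mono fun n h _ => h
      filter_upwards [e1, e2, ht.eventually_ge_atTop 1, hb.eventually_le_const one_pos,
        eventually_ge_atTop 1] with n h1 h2 h3 h4 h5
      exact h n (b n) h5 (hb0 n) h4 (s n) (hs n) h1 h2 h3
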